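/- All groups are finite. Let $\sigma=\{\sigma_i\mid i\in I\}$ be a partition of the set of all primes, and let $\sigma(G)$ be the set of those $\sigma_i$ that contain a prime divisor of $|G|$. A group is *$\sigma$-primary* if it is a $\sigma_i$-group for some $i$; *$\sigma$-nilpotent* if it is a direct product of $\sigma$-primary groups; *$\sigma$-soluble* if each of its chief factors is $\sigma$-primary; *$\sigma$-full* if it has a Hall $\sigma_i$-subgroup for every $\sigma_i\in\sigma(G)$. Write $G^{\mathfrak N_\sigma}$ for the intersection of all normal subgroups $N$ of $G$ with $G/N$ $\sigma$-nilpotent. A subgroup $A$ of $G$ is *$\sigma$-subnormal* in $G$ if there is a chain $A=A_0\le A_1\le\dots\le A_n=G$ such that, for each $k$, either $A_{k-1}\trianglelefteq A_k$ or $A_k/(A_{k-1})_{A_k}$ is $\sigma$-primary, where $(A_{k-1})_{A_k}$ is the core of $A_{k-1}$ in $A_k$. It is *$\sigma$-permutable* in $G$ if either $A\trianglelefteq G$, or $G$ is $\sigma$-full and $AH=HA$ for every $\sigma_i\in\sigma(G)$ and every Hall $\sigma_i$-subgroup $H$ of $G$. The group $G$ is a *$P\sigma T$-group* if, whenever $H$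 is $\sigma$-permutable in $K$ and $K$ is $\sigma$-permutable in $G$, $H$ is $\sigma$-permutable in $G$. A *subgroup functor* $\tau$ on the class $\mathfrak X$ of all $\sigma$-full groups assigns to each $G\in\mathfrak X$ a set $\tau(G)$ of subgroups of $G$ such that $G\in\tau(G)$ and, for every epimorphism $\varphi:A\to B$ with $A,B\in\mathfrak X$ and all $H\in\tau(A)$, $T\in\tau(B)$, we have $\varphi(H)\in\tau(B)$ and $\varphi^{-1}(T)\in\tau(A)$. It is *$\sigma$-special* if for every $G\in\mathfrak X$: (\*) every $\sigma$-subnormal subgroup of $G$ that belongs to $\tau(G)$ is $\sigma$-permutable in $G$; (\*\*) $\langle A,B\rangle\in\tau(G)$ for all $\sigma$-subnormal subgroups $A,B\in\tau(G)$ of $G$; (\*\*\*) if $G=D\rtimes M$ is a $\sigma$-soluble $P\sigma T$-group with $D=G^{\mathfrak N_\sigma}$, and $A\in\tau(M)$ is $\sigma$-primary and $\sigma$-subnormal in $G$, then $A\in\tau(G)$. **Theorem 2.11.** Let $\tau$ be a $\sigma$-special subgroup functor on the class of all $\sigma$-full groups, let $G$ be a $\sigma$-soluble group and let $D=G^{\mathfrak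 N_\sigma}$. If every $\sigma$-subnormal subgroup of $G$ belongs to $\tau(G)$, then $G$ is a $P\sigma T$-group and there is a subgroup $M$ of $G$ such that the following conditions hold: (i) $G=D\rtimes M$, where $D$ is an abelian Hall subgroup of $G$ of odd order, $M$ is $\sigma$-nilpotent with $U\in\tau(M)$ for all subgroups $U$ of $M$, and every element of $G$ induces by conjugation a power automorphism of $D$ (that is, an automorphism mapping every subgroup of $D$ onto itself); (ii) for every $i\in I$, the largest normal $\sigma_i$-subgroup $O_{\sigma_i}(D)$ of $D$ has a normal complement in some Hall $\sigma_i$-subgroup of $G$. Conversely, if Conditions (i) and (ii) hold for $D=G^{\mathfrak N_\sigma}$ and some subgroup $M$ of $G$, then every $\sigma$-subnormal subgroup of $G$ belongs to $\tau(G)$. -/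

import Mathlib

open scoped Pointwise

universe u v

namespace SigmaTheory

/-- `σ` is a partition of the set of all primes: the classes `σ i` cover exactly the primes and
are pairwise disjoint. -/
def IsPrimePartition {I : Type v} (σ : I → Set ℕ) : Prop :=
  (⋃ i, σ i) = {p : ℕ | p.Prime} ∧ ∀ i j, i ≠ j → σ i ∩ σ j = ∅

/-- A (finite) group is a `π`-group if all prime divisors of its order lie in `π`.
Only the order of the group enters. -/
def IsPiGroup (π : Set ℕ) (G : Type*) : Prop :=
  ∀ p : ℕ, p.Prime → p ∣ Nat.card G → p ∈ π

/-- `G` is `σ`-primary: it is a `σ i`-group for some `i` (the trivial group is allowed). -/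
def IsSigmaPrimary {I : Type v} (σ : I → Set ℕ) (G : Type*) : Prop :=
  ∃ i, IsPiGroup (σ i) G

/-- `G` is `σ`-nilpotent: it is a (finite) direct product of `σ`-primary groups. -/
def IsSigmaNilpotent {I : Type v} (σ : I → Set ℕ) (G : Type u) [Group G] : Prop :=
  ∃ (n : ℕ) (H : Fin n → Type u) (_ : ∀ k, Group (H k)),
    (∀ k, IsSigmaPrimary σ (H k)) ∧ Nonempty (G ≃* ((k : Fin n) → H k))

/-- `H / K` is a chief factor of `G`: `K < H` are normal subgroups of `G` and no normal subgroup
of `G` lies strictly between them. -/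
def IsChiefFactor {G : Type*} [Group G] (H K : Subgroup G) : Prop :=
  H.Normal ∧ K.Normal ∧ K < H ∧ ∀ N : Subgroup G, N.Normal → K ≤ N → N ≤ H → N = K ∨ N = H

/-- `G` is `σ`-soluble: every chief factor of `G` is `σ`-primary. -/
def IsSigmaSoluble {I : Type v} (σ : I → Set ℕ) (G : Type*) [Group G] : Prop :=
  ∀ H K : Subgroup G, IsChiefFactor H K → IsSigmaPrimary σ (↥H ⧸ K.subgroupOf H)

/-- One step of a `σ`-subnormal chain: `A ≤ B`, and either `A` is normal in `B` or the quotient of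
`B` by the core of `A` in `B` is `σ`-primary. -/
def SigmaSubnormalStep {I : Type v} (σ : I → Set ℕ) {G : Type*} [Group G]
    (A B : Subgroup G) : Prop :=
  A ≤ B ∧ ((A.subgroupOf B).Normal ∨ IsSigmaPrimary σ (↥B ⧸ (A.subgroupOf B).normalCore))

/-- `A` is `σ`-subnormal in `G`: there is a finite chain of such steps from `A` to `G`. -/
def IsSigmaSubnormal {I : Type v} (σ : I → Set ℕ) {G : Type*} [Group G]
    (A : Subgroup G) : Prop :=
  Relation.ReflTransGen (SigmaSubnormalStep σ) A ⊤

/-- `H` is a Hall `π`-subgroup of `G`: a `π`-subgroup whose index is divisible by no prime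
of `π`. -/
def IsHallPi {G : Type*} [Group G] (π : Set ℕ) (H : Subgroup G) : Prop :=
  IsPiGroup π ↥H ∧ ∀ p : ℕ, p.Prime → p ∣ H.index → p ∉ π

/-- `H` is a Hall subgroup of `G`: its order and its index are coprime. -/
def IsHall {G : Type*} [Group G] (H : Subgroup G) : Prop :=
  Nat.Coprime (Nat.card ↥H) H.index

/-- `σ i ∈ σ(G)`: some prime of `σ i` divides the order of `G`. -/
def MemSigma {I : Type v} (σ : I → Set ℕ) (G : Type*) (i : I) : Prop :=
  ∃ p ∈ σ i, p ∣ Nat.card G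

/-- `G` is `σ`-full: it has a Hall `σ i`-subgroup for every `σ i ∈ σ(G)`. -/
def IsSigmaFull {I : Type v} (σ : I → Set ℕ) (G : Type*) [Group G] : Prop :=
  ∀ i, MemSigma σ G i → ∃ H : Subgroup G, IsHallPi (σ i) H

/-- `A` permutes with `B`: `AB = BA`. -/
def Permutes {G : Type*} [Group G] (A B : Subgroup G) : Prop :=
  (A : Set G) * (B : Set G) = (B : Set G) * (A : Set G)

/-- `A` is `σ`-permutable in `G`: either `A` is normal in `G`, or `G` is `σ`-full and `A` permutes
with every Hall `σ i`-subgroup of `G`, for every `σ i ∈ σ(G)`. -/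
def IsSigmaPermutable {I : Type v} (σ : I → Set ℕ) {G : Type*} [Group G]
    (A : Subgroup G) : Prop :=
  A.Normal ∨ (IsSigmaFull σ G ∧
    ∀ i, MemSigma σ G i → ∀ H : Subgroup G, IsHallPi (σ i) H → Permutes A H)

/-- `G` is a `PσT`-group: `σ`-permutability is transitive in `G`. -/
def IsPSigmaTGroup {I : Type v} (σ : I → Set ℕ) (G : Type*) [Group G] : Prop :=
  ∀ (K : Subgroup G) (H : Subgroup ↥K), IsSigmaPermutable σ H → IsSigmaPermutable σ K →
    IsSigmaPermutable σ (H.map K.subtype)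

/-- The `σ`-nilpotent residual of `G`: the intersection of all normal subgroups `N` of `G` with
`σ`-nilpotent quotient `G / N`. -/
def sigmaNilpotentResidual {I : Type v} (σ : I → Set ℕ) (G : Type u) [Group G] : Subgroup G :=
  sInf {N : Subgroup G | ∃ _ : N.Normal, IsSigmaNilpotent σ (G ⧸ N)}

/-- `G = D ⋊ M` (internal semidirect product): `D` is normal in `G` and `M` is a complement
of `D` in `G`. -/
def IsSemidirect {G : Type*} [Group G] (D M : Subgroup G) : Prop :=
  D.Normal ∧ Subgroup.IsComplement' D M

/-- `O_π(G)`: the subgroup generated by all normal `π`-subgroups of `G`. -/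
def piCore (π : Set ℕ) (G : Type*) [Group G] : Subgroup G :=
  sSup {N : Subgroup G | N.Normal ∧ IsPiGroup π ↥N}

/-- `O` is a subgroup of `H` that has a normal complement in `H`. -/
def HasNormalComplementIn {G : Type*} [Group G] (O H : Subgroup G) : Prop :=
  O ≤ H ∧ ∃ S : Subgroup ↥H, S.Normal ∧ Subgroup.IsComplement' S (O.subgroupOf H)

/-- A power automorphism of a group maps every subgroup onto itself. -/
def IsPowerAutomorphism {G : Type*} [Group G] (α : MulAut G) : Prop :=
  ∀ K : Subgroup G, K.map α.toMonoidHom = K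

/-- An assignment of a set `τ(G)` of subgroups to every group `G`. It is constrained, and used,
only on finite `σ`-full groups. -/
abbrev SubgroupSystem : Type (u + 1) :=
  (G : Type u) → [Group G] → Set (Subgroup G)

/-- `τ` is a subgroup functor in the sense of Skiba on the class of finite `σ`-full groups. -/
structure IsSubgroupFunctor {I : Type v} (σ : I → Set ℕ) (τ : SubgroupSystem.{u}) : Prop where
  top_mem : ∀ (G : Type u) [Group G] [Finite G], IsSigmaFull σ G → (⊤ : Subgroup G) ∈ τ G
  map_mem : ∀ (A B : Type u) [Group A] [Finite A] [Group B] [Finite B],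
    IsSigmaFull σ A → IsSigmaFull σ B → ∀ φ : A →* B, Function.Surjective φ →
      ∀ H ∈ τ A, H.map φ ∈ τ B
  comap_mem : ∀ (A B : Type u) [Group A] [Finite A] [Group B] [Finite B],
    IsSigmaFull σ A → IsSigmaFull σ B → ∀ φ : A →* B, Function.Surjective φ →
      ∀ T ∈ τ B, T.comap φ ∈ τ A

/-- The subgroup functor `τ` on the class of finite `σ`-full groups is `σ`-special. -/
structure IsSigmaSpecial {I : Type v} (σ : I → Set ℕ) (τ : SubgroupSystem.{u}) : Prop
    extends IsSubgroupFunctor σ τ where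
  permutable : ∀ (G : Type u) [Group G] [Finite G], IsSigmaFull σ G →
    ∀ A : Subgroup G, IsSigmaSubnormal σ A → A ∈ τ G → IsSigmaPermutable σ A
  sup_mem : ∀ (G : Type u) [Group G] [Finite G], IsSigmaFull σ G →
    ∀ A B : Subgroup G, IsSigmaSubnormal σ A → IsSigmaSubnormal σ B →
      A ∈ τ G → B ∈ τ G → A ⊔ B ∈ τ G
  lift_mem : ∀ (G : Type u) [Group G] [Finite G], IsSigmaFull σ G →
    IsSigmaSoluble σ G → IsPSigmaTGroup σ G →
    ∀ M : Subgroup G, IsSemidirect (sigmaNilpotentResidual σ G) M →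
    ∀ A : Subgroup ↥M, IsSigmaPrimary σ ↥A → IsSigmaSubnormal σ (A.map M.subtype) →
      A ∈ τ ↥M → A.map M.subtype ∈ τ G

/-- The structural conditions on subgroups `D` and `M` of `G`. -/
structure StructureConditions {I : Type v} (σ : I → Set ℕ) (τ : SubgroupSystem.{u})
    {G : Type u} [Group G] (D M : Subgroup G) : Prop where
  [normal : D.Normal]
  semidirect : IsSemidirect D M
  abelian : ∀ x ∈ D, ∀ y ∈ D, x * y = y * x
  hall : IsHall D
  odd : Odd (Nat.card ↥D)
  nilpotent : IsSigmaNilpotent σ ↥M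
  mem : ∀ U : Subgroup ↥M, U ∈ τ ↥M
  power : ∀ g : G, IsPowerAutomorphism (MulAut.conjNormal g : MulAut ↥D)
  complement : ∀ i, ∃ H : Subgroup G, IsHallPi (σ i) H ∧
    HasNormalComplementIn ((piCore (σ i) ↥D).map D.subtype) H

end SigmaTheory

open SigmaTheory

/-! Everything is read off from elements of prime power order. Call primes separated if no class of
`σ` contains both. A finite group is `σ`-nilpotent exactly when elements of separated prime power
orders commute. Hence the residual D is the subgroup `sigmaCommutator` generated by their
commutators; it is compatible with quotients because p-elements lift along epimorphisms.

From `τ` to structure. By (*) every `σ`-subnormal subgroup permutes with every Hall `σ i`-subgroup.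
An order count then shows that `σ i'`-elements normalise every subgroup of every normal `σ
i`-section (`NormalisesSections`), so they act there by power automorphisms. On a minimal normal
subgroup such an action is either trivial or a uniform power on an elementary abelian group, so it
commutes with all of G. Thus D centralises the minimal normal subgroups, and induction on |G| makes
D nilpotent. Factoring out the p'-part of D leaves a p-group residual on which some q-element g,
with q separated from p, acts nontrivially. A power automorphism of p'-order on a p-group that fixes
a nontrivial element is trivial, so g acts without fixed points on a Sylow p-subgroup P. Then P =
[P, g] ≤ D, which gives the Hall property, and P is abelian and p is odd. The same argument shows
that `σ i`-elements of G centralise the `σ i`-part of D. These facts form `ResidualConditions`; the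
Schur-Zassenhaus theorem then supplies M and the normal complements.

From structure to `τ`. The structural conditions imply `ResidualConditions`, and they put every
overgroup of D into `τ G`, as a preimage of a subgroup of M. For a `σ`-subnormal A the intersection
A ∩ D is normal, so passing to the quotient one may assume A ∩ D = 1. Then A centralises D:
otherwise an element of A would act without fixed points on a cyclic p-subgroup E of D, and E = [E,
a] would lie in A by `σ`-subnormality. It follows that A is generated by its `σ i`-parts, each lying
in every complement of D. Condition (***) lifts each part from M to G, and (**) joins them. The
`PσT` property required by (***) holds because, in a `σ`-soluble group, permuting with Hall
subgroups implies `σ`-subnormality, a transitive relation, and `ResidualConditions` gives the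
reverse implication. -/

open scoped commutatorElement

namespace SigmaTheory

/-! ### Elements of prime power order and the subgroups they generate -/

section Elements

variable {G : Type*} [Group G] {G' : Type*} [Group G']

/-- `x` is a `p`-element: its order is a power of `p`. -/
def IsPElt (p : ℕ) (x : G) : Prop := ∃ k : ℕ, x ^ p ^ k = 1

/-- All prime divisors of `n` lie in `π`. -/
def IsPiNumber (π : Set ℕ) (n : ℕ) : Prop := ∀ p : ℕ, p.Prime → p ∣ n → p ∈ π

theorem IsPiNumber.of_dvd {π : Set ℕ} {m n : ℕ} (h : IsPiNumber π n) (hmn : m ∣ n) :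
    IsPiNumber π m := fun p hp hd => h p hp (hd.trans hmn)

theorem IsPiNumber.mul {π : Set ℕ} {m n : ℕ} (hm : IsPiNumber π m) (hn : IsPiNumber π n) :
    IsPiNumber π (m * n) := fun p hp hd => (hp.dvd_mul.1 hd).elim (hm p hp) (hn p hp)

theorem IsPiNumber.coprime {π : Set ℕ} {m n : ℕ} (hm : IsPiNumber π m)
    (hn : ∀ p : ℕ, p.Prime → p ∣ n → p ∉ π) : Nat.Coprime m n :=
  Nat.coprime_of_dvd fun p hp h1 h2 => hn p hp h2 (hm p hp h1)

theorem IsPElt.map {p : ℕ} {x : G} (h : IsPElt p x) (f : G →* G') : IsPElt p (f x) := by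
  obtain ⟨k, hk⟩ := h
  exact ⟨k, by rw [← map_pow, hk, map_one]⟩

theorem IsPElt.of_map {p : ℕ} {x : G} {f : G →* G'} (hf : Function.Injective f)
    (h : IsPElt p (f x)) : IsPElt p x := by
  obtain ⟨k, hk⟩ := h
  exact ⟨k, hf (by rw [map_pow, hk, map_one])⟩

theorem IsPElt.coe {p : ℕ} {K : Subgroup G} {x : K} (h : IsPElt p x) : IsPElt p (x : G) :=
  h.map K.subtype

theorem IsPElt.of_coe {p : ℕ} {K : Subgroup G} {x : K} (h : IsPElt p (x : G)) : IsPElt p x :=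
  h.of_map (f := K.subtype) K.subtype_injective

theorem IsPElt.inv {p : ℕ} {x : G} (h : IsPElt p x) : IsPElt p x⁻¹ := by
  obtain ⟨k, hk⟩ := h
  exact ⟨k, by rw [inv_pow, hk, inv_one]⟩

theorem IsPElt.zpow {p : ℕ} {x : G} (h : IsPElt p x) (n : ℤ) : IsPElt p (x ^ n) := by
  obtain ⟨k, hk⟩ := h
  refine ⟨k, ?_⟩
  rw [← zpow_natCast, ← zpow_mul, mul_comm, zpow_mul, zpow_natCast, hk, one_zpow]

theorem IsPElt.conj {p : ℕ} {x : G} (h : IsPElt p x) (g : G) : IsPElt p (g * x * g⁻¹) := by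
  simpa using h.map (MulAut.conj g).toMonoidHom

theorem IsPElt.eq_one {p q : ℕ} (hp : p.Prime) (hq : q.Prime) (hpq : p ≠ q) {x : G}
    (h : IsPElt p x) (h' : IsPElt q x) : x = 1 := by
  obtain ⟨k, hk⟩ := h
  obtain ⟨l, hl⟩ := h'
  have hc : Nat.Coprime (p ^ k) (q ^ l) := Nat.Coprime.pow _ _ ((Nat.coprime_primes hp hq).2 hpq)
  have := Nat.eq_one_of_dvd_coprimes hc (orderOf_dvd_of_pow_eq_one hk)
    (orderOf_dvd_of_pow_eq_one hl)
  exact orderOf_eq_one_iff.1 this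

theorem IsPElt.eq_one_of_not_dvd [Finite G] {p : ℕ} (hp : p.Prime) {x : G} (h : IsPElt p x)
    {n : ℕ} (hx : x ^ n = 1) (hn : ¬ p ∣ n) : x = 1 := by
  obtain ⟨k, hk⟩ := h
  have hc : Nat.Coprime (p ^ k) n := Nat.Coprime.pow_left _ ((hp.coprime_iff_not_dvd).2 hn)
  exact orderOf_eq_one_iff.1 (Nat.eq_one_of_dvd_coprimes hc (orderOf_dvd_of_pow_eq_one hk)
    (orderOf_dvd_of_pow_eq_one hx))

theorem IsPElt.isPGroup_zpowers {p : ℕ} {x : G} (h : IsPElt p x) :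
    IsPGroup p (Subgroup.zpowers x) := by
  rintro ⟨y, n, rfl⟩
  obtain ⟨k, hk⟩ := h.zpow n
  exact ⟨k, Subtype.ext hk⟩

/-- A subgroup containing all powers of `x` of prime power order contains `x`. -/
theorem mem_of_pElt_pow_mem [Finite G] {S : Subgroup G} (x : G)
    (h : ∀ p : ℕ, p.Prime → ∀ n : ℕ, IsPElt p (x ^ n) → x ^ n ∈ S) : x ∈ S := by
  -- Induction on the factorisation of the exponent m. The power n stays free because the coprime
  -- case splits `x ^ n` by Bezout into powers of `x ^ (n * a)` and `x ^ (n * b)`.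
  suffices H : ∀ m n : ℕ, (x ^ n) ^ m = 1 → 0 < m → x ^ n ∈ S by
    simpa using H (orderOf x) 1 (by simp [pow_orderOf_eq_one]) (orderOf_pos x)
  intro m
  induction m using Nat.recOnPosPrimePosCoprime with
  | zero => simp
  | one => intro n hn _; rw [pow_one] at hn; rw [hn]; exact S.one_mem
  | prime_pow p k hp hk => intro n hn _; exact h p hp n ⟨k, hn⟩
  | coprime a b ha hb hab iha ihb =>
    intro n hn _
    have h1 : x ^ (n * a) ∈ S := ihb (n * a) (by rw [pow_mul, ← pow_mul, hn]) (by omega)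
    have h2 : x ^ (n * b) ∈ S := iha (n * b) (by
      rw [pow_mul, ← pow_mul, mul_comm b a, hn]) (by omega)
    have hbz : (a : ℤ) * a.gcdA b + b * a.gcdB b = 1 := by
      rw [← Nat.gcd_eq_gcd_ab]; exact_mod_cast hab
    have : x ^ n = (x ^ (n * a)) ^ (a.gcdA b) * (x ^ (n * b)) ^ (a.gcdB b) := by
      rw [pow_mul, pow_mul, ← zpow_natCast (x ^ n) a, ← zpow_natCast (x ^ n) b, ← zpow_mul,
        ← zpow_mul, ← zpow_add, hbz, zpow_one]
    rw [this]
    exact S.mul_mem (S.zpow_mem h1 _) (S.zpow_mem h2 _)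

theorem le_of_pElt_mem [Finite G] {K S : Subgroup G}
    (h : ∀ p : ℕ, p.Prime → ∀ x ∈ K, IsPElt p x → x ∈ S) : K ≤ S := fun x hx =>
  mem_of_pElt_pow_mem x fun p hp _ hn => h p hp _ (K.pow_mem hx _) hn

/-- `p`-elements lift along surjections. -/
theorem IsPElt.lift [Finite G] {p : ℕ} (hp : p.Prime) {f : G →* G'} (hf : Function.Surjective f)
    {y : G'} (hy : IsPElt p y) : ∃ x : G, IsPElt p x ∧ f x = y := by
  obtain ⟨x, rfl⟩ := hf y
  obtain ⟨k, hk⟩ := hy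
  obtain ⟨a, m, hm, hx⟩ := Nat.exists_eq_pow_mul_and_not_dvd (orderOf_pos x).ne' p hp.ne_one
  have hc : Nat.Coprime (p ^ k) m := Nat.Coprime.pow_left _ ((hp.coprime_iff_not_dvd).2 hm)
  -- The exponent e kills the p'-part of x, since m divides e, and fixes the image, since e is 1
  -- modulo `p ^ k`.
  obtain ⟨e, he1, he2⟩ := Nat.chineseRemainder hc 1 0
  refine ⟨x ^ e, ⟨a, ?_⟩, ?_⟩
  · obtain ⟨c, rfl⟩ := (Nat.modEq_zero_iff_dvd).1 he2
    rw [← pow_mul, show m * c * p ^ a = orderOf x * c by rw [hx]; ring, pow_mul,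
      pow_orderOf_eq_one, one_pow]
  · rw [map_pow]
    have : e ≡ 1 [MOD orderOf (f x)] := he1.of_dvd (orderOf_dvd_of_pow_eq_one hk)
    simpa using (pow_eq_pow_iff_modEq).2 this

theorem IsPElt.exists_sylow {p : ℕ} {x : G} (h : IsPElt p x) : ∃ P : Sylow p G, x ∈ P := by
  obtain ⟨P, hP⟩ := h.isPGroup_zpowers.exists_le_sylow
  exact ⟨P, hP (Subgroup.mem_zpowers x)⟩

theorem exists_pElt_ne_one [Finite G] {p : ℕ} (hp : p.Prime) (h : p ∣ Nat.card G) :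
    ∃ x : G, x ≠ 1 ∧ x ^ p = 1 := by
  have := Fact.mk hp
  obtain ⟨x, hx⟩ := exists_prime_orderOf_dvd_card' p h
  refine ⟨x, ?_, by rw [← hx, pow_orderOf_eq_one]⟩
  rintro rfl
  exact hp.ne_one (by simpa using hx.symm)

theorem isPiGroup_iff_forall_pElt [Finite G] {π : Set ℕ} :
    IsPiGroup π G ↔ ∀ p : ℕ, p.Prime → p ∉ π → ∀ x : G, IsPElt p x → x = 1 := by
  constructor
  · intro h p hp hpπ x hx
    exact hx.eq_one_of_not_dvd hp pow_card_eq_one' fun hd => hpπ (h p hp hd)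
  · intro h p hp hd
    by_contra hpπ
    obtain ⟨x, hx1, hx⟩ := exists_pElt_ne_one hp hd
    exact hx1 (h p hp hpπ x ⟨1, by simpa using hx⟩)

theorem isPiGroup_coe_iff [Finite G] {π : Set ℕ} {K : Subgroup G} :
    IsPiGroup π K ↔ ∀ p : ℕ, p.Prime → p ∉ π → ∀ x ∈ K, IsPElt p x → x = 1 := by
  rw [isPiGroup_iff_forall_pElt]
  constructor
  · intro h p hp hpπ x hx hxp
    simpa using h p hp hpπ ⟨x, hx⟩ hxp.of_coe
  · intro h p hp hpπ x hxp
    simpa using h p hp hpπ x x.2 hxp.coe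

/-- If `C` contains all `p`-elements of `B` for `p ∉ π`, then `|B : B ∩ C|` is a `π`-number. -/
theorem isPiNumber_relIndex [Finite G] {π : Set ℕ} {B C : Subgroup G}
    (h : ∀ p : ℕ, p.Prime → p ∉ π → ∀ x ∈ B, IsPElt p x → x ∈ C) :
    IsPiNumber π (C.relIndex B) := by
  intro p hp hd
  by_contra hpπ
  have := Fact.mk hp
  obtain ⟨P⟩ : Nonempty (Sylow p B) := inferInstance
  have hPC : (P : Subgroup B) ≤ C.subgroupOf B := by
    intro x hx
    obtain ⟨k, hk⟩ := P.isPGroup' ⟨x, hx⟩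
    have hx' : IsPElt p x := ⟨k, by simpa using congrArg Subtype.val hk⟩
    exact Subgroup.mem_subgroupOf.2 (h p hp hpπ x x.2 hx'.coe)
  exact P.not_dvd_index (hd.trans (Subgroup.index_dvd_of_le hPC))

/-- If `B` normalises `C` and `|B : B ∩ C|` is a `π`-number, then `C` contains the `p`-elements
of `B` for `p ∉ π`. -/
theorem pElt_mem_of_isPiNumber_relIndex [Finite G] {π : Set ℕ} {B C : Subgroup G}
    (hBC : B ≤ Subgroup.normalizer (C : Set G)) (h : IsPiNumber π (C.relIndex B))
    {p : ℕ} (hp : p.Prime) (hpπ : p ∉ π) {x : G} (hx : x ∈ B) (hxp : IsPElt p x) : x ∈ C := by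
  have hn : (C.subgroupOf B).Normal := by
    refine ⟨fun n hn g => ?_⟩
    rw [Subgroup.mem_subgroupOf] at hn ⊢
    exact (Subgroup.mem_normalizer_iff.1 (hBC g.2) n).1 hn
  have h1 : (QuotientGroup.mk' (C.subgroupOf B)) ⟨x, hx⟩ = 1 := by
    refine (IsPElt.map (IsPElt.of_coe hxp) _).eq_one_of_not_dvd hp (n := C.relIndex B) ?_
      fun hd => hpπ (h p hp hd)
    exact pow_card_eq_one'
  rw [QuotientGroup.mk'_apply, QuotientGroup.eq_one_iff] at h1
  exact h1

/-- The subgroup generated by the `p`-elements of `K` with `p ∈ π`. -/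
def piGen (π : Set ℕ) (K : Subgroup G) : Subgroup G :=
  Subgroup.closure {x | x ∈ K ∧ ∃ p : ℕ, p.Prime ∧ p ∈ π ∧ IsPElt p x}

theorem mem_piGen {π : Set ℕ} {K : Subgroup G} {p : ℕ} (hp : p.Prime) (hpπ : p ∈ π) {x : G}
    (hx : x ∈ K) (hxp : IsPElt p x) : x ∈ piGen π K :=
  Subgroup.subset_closure ⟨hx, p, hp, hpπ, hxp⟩

theorem piGen_le {π : Set ℕ} {K S : Subgroup G}
    (h : ∀ p : ℕ, p.Prime → p ∈ π → ∀ x ∈ K, IsPElt p x → x ∈ S) : piGen π K ≤ S := by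
  rw [piGen, Subgroup.closure_le]
  rintro x ⟨hx, p, hp, hpπ, hxp⟩
  exact h p hp hpπ x hx hxp

theorem piGen_le_self {π : Set ℕ} {K : Subgroup G} : piGen π K ≤ K := piGen_le fun _ _ _ _ h _ => h

theorem normalizer_le_of_conj_mem {S : Subgroup G} {B : Subgroup G}
    (h : ∀ b ∈ B, ∀ x ∈ S, b * x * b⁻¹ ∈ S) : B ≤ Subgroup.normalizer (S : Set G) := by
  intro b hb
  rw [Subgroup.mem_normalizer_iff]
  intro x
  refine ⟨h b hb x, fun hx => ?_⟩
  have := h b⁻¹ (B.inv_mem hb) _ hx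
  simpa [mul_assoc] using this

theorem normalizer_le_normalizer_closure {B : Subgroup G} {s : Set G}
    (h : ∀ b ∈ B, ∀ x ∈ s, b * x * b⁻¹ ∈ s) :
    B ≤ Subgroup.normalizer (Subgroup.closure s : Set G) := by
  refine normalizer_le_of_conj_mem fun b hb x hx => ?_
  have : (Subgroup.closure s).map (MulAut.conj b).toMonoidHom ≤ Subgroup.closure s := by
    rw [MonoidHom.map_closure, Subgroup.closure_le]
    rintro _ ⟨y, hy, rfl⟩
    exact Subgroup.subset_closure (by simpa using h b hb y hy)
  exact this ⟨x, hx, by simp⟩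

theorem normalizer_le_normalizer_piGen {π : Set ℕ} {K B : Subgroup G}
    (h : B ≤ Subgroup.normalizer (K : Set G)) :
    B ≤ Subgroup.normalizer (piGen π K : Set G) := by
  refine normalizer_le_normalizer_closure ?_
  rintro b hb x ⟨hx, p, hp, hpπ, hxp⟩
  exact ⟨(Subgroup.mem_normalizer_iff.1 (h hb) x).1 hx, p, hp, hpπ, hxp.conj b⟩

instance piGen_normal {π : Set ℕ} {K : Subgroup G} [K.Normal] : (piGen π K).Normal := by
  rw [← Subgroup.normalizer_eq_top_iff, eq_top_iff]
  exact normalizer_le_normalizer_piGen (by rw [Subgroup.normalizer_eq_top])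

/-- If the `π`-elements and the `π'`-elements of `K` commute, then the `π`-elements generate
a `π`-group. -/
theorem isPiGroup_piGen [Finite G] {π : Set ℕ} {K : Subgroup G}
    (h : ∀ p q : ℕ, p.Prime → q.Prime → p ∈ π → q ∉ π → ∀ x ∈ K, ∀ y ∈ K, IsPElt p x →
      IsPElt q y → Commute x y) : IsPiGroup π (piGen π K) := by
  intro q hq hd
  by_contra hqπ
  have := Fact.mk hq
  obtain ⟨Q⟩ : Nonempty (Sylow q (piGen π K)) := inferInstance
  have hcen : ∀ y ∈ Q, ∀ x : piGen π K, x * y = y * x := by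
    intro y hy x
    obtain ⟨k, hk⟩ := Q.isPGroup' ⟨y, hy⟩
    have hy' : IsPElt q (y : G) := IsPElt.coe ⟨k, by simpa using congrArg Subtype.val hk⟩
    have : piGen π K ≤ Subgroup.centralizer {(y : G)} := by
      refine piGen_le fun p hp hpπ z hz hzp => ?_
      rw [Subgroup.mem_centralizer_singleton_iff]
      exact h p q hp hq hpπ hqπ z hz y (piGen_le_self y.2) hzp hy'
    exact Subtype.ext (Subgroup.mem_centralizer_singleton_iff.1 (this x.2))
  -- Q is central, so Burnside's transfer theorem gives a normal complement to Q. It contains every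
  -- generator, as these have order prime to q, and so it is the whole group.
  have hQ : Subgroup.normalizer (Q : Set (piGen π K)) ≤
      Subgroup.centralizer (Q : Set (piGen π K)) := by
    intro x _ y hy
    exact (hcen y hy x).symm
  set N := (MonoidHom.transferSylow Q hQ).ker
  have hN := MonoidHom.ker_transferSylow_isComplement' Q hQ
  have hle : piGen π K ≤ N.map (piGen π K).subtype := by
    refine piGen_le fun p hp hpπ z hz hzp => ?_
    have hz' : z ∈ piGen π K := mem_piGen hp hpπ hz hzp
    refine ⟨⟨z, hz'⟩, ?_, rfl⟩
    have h1 : IsPElt p (MonoidHom.transferSylow Q hQ ⟨z, hz'⟩) := (IsPElt.of_coe hzp).map _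
    have h2 : IsPElt q (MonoidHom.transferSylow Q hQ ⟨z, hz'⟩) := Q.isPGroup' _
    exact h1.eq_one hp hq (fun hpq => hqπ (hpq ▸ hpπ)) h2
  have hNtop : N = ⊤ := by
    rw [eq_top_iff]
    intro x _
    obtain ⟨y, hy, hyx⟩ := hle x.2
    rwa [← Subtype.ext hyx]
  have hcard : Nat.card Q = 1 := by
    rw [← hN.symm.index_eq_card]
    exact Subgroup.index_eq_one.2 hNtop
  have hne := Q.ne_bot_of_dvd_card hd
  exact hne (Subgroup.card_eq_one.1 hcard)

end Elements

/-! ### The `σ`-nilpotent residual as a commutator subgroup -/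

section Residual

variable {I : Type v} {σ : I → Set ℕ} {G : Type*} [Group G] {G' : Type*} [Group G']

/-- The primes `p` and `q` lie in no common class of `σ`. -/
def SepPrimes (σ : I → Set ℕ) (p q : ℕ) : Prop :=
  p.Prime ∧ q.Prime ∧ ∀ i, p ∈ σ i → q ∉ σ i

theorem SepPrimes.symm {p q : ℕ} (h : SepPrimes σ p q) : SepPrimes σ q p :=
  ⟨h.2.1, h.1, fun i hq hp => h.2.2 i hp hq⟩

theorem IsPrimePartition.exists_mem (hσ : IsPrimePartition σ) {p : ℕ} (hp : p.Prime) :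
    ∃ i, p ∈ σ i := by
  have : p ∈ ⋃ i, σ i := by rw [hσ.1]; exact hp
  simpa using this

theorem IsPrimePartition.prime (hσ : IsPrimePartition σ) {p : ℕ} {i : I} (hp : p ∈ σ i) :
    p.Prime := by
  have : p ∈ ⋃ i, σ i := Set.mem_iUnion.2 ⟨i, hp⟩
  rwa [hσ.1] at this

theorem IsPrimePartition.eq (hσ : IsPrimePartition σ) {p : ℕ} {i j : I} (hi : p ∈ σ i)
    (hj : p ∈ σ j) : i = j := by
  by_contra hij
  have : p ∈ σ i ∩ σ j := ⟨hi, hj⟩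
  rw [hσ.2 i j hij] at this
  exact this

theorem IsPrimePartition.sep (hσ : IsPrimePartition σ) {p q : ℕ} {i : I} (hp : p ∈ σ i)
    (hq : q.Prime) (hqi : q ∉ σ i) : SepPrimes σ p q :=
  ⟨hσ.prime hp, hq, fun _ hj => hσ.eq hp hj ▸ hqi⟩

theorem IsPrimePartition.exists_common_or_sep (σ : I → Set ℕ) {p q : ℕ}
    (hp : p.Prime) (hq : q.Prime) : (∃ i, p ∈ σ i ∧ q ∈ σ i) ∨ SepPrimes σ p q := by
  by_cases h : ∃ i, p ∈ σ i ∧ q ∈ σ i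
  · exact Or.inl h
  · exact Or.inr ⟨hp, hq, fun i h1 h2 => h ⟨i, h1, h2⟩⟩

theorem SepPrimes.ne (hσ : IsPrimePartition σ) {p q : ℕ} (h : SepPrimes σ p q) : p ≠ q := by
  rintro rfl
  obtain ⟨i, hi⟩ := hσ.exists_mem h.1
  exact h.2.2 i hi hi

/-- The subgroup generated by the commutators of `p`-elements with `q`-elements, where `p` and `q`
lie in different classes of `σ`. -/
def sigmaCommutator (σ : I → Set ℕ) (G : Type*) [Group G] : Subgroup G :=
  Subgroup.closure {z | ∃ p q : ℕ, ∃ x y : G,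
    SepPrimes σ p q ∧ IsPElt p x ∧ IsPElt q y ∧ ⁅x, y⁆ = z}

theorem commutator_mem_sigmaCommutator {p q : ℕ} {x y : G} (h : SepPrimes σ p q)
    (hx : IsPElt p x) (hy : IsPElt q y) : ⁅x, y⁆ ∈ sigmaCommutator σ G :=
  Subgroup.subset_closure ⟨p, q, x, y, h, hx, hy, rfl⟩

theorem sigmaCommutator_le {S : Subgroup G}
    (h : ∀ p q : ℕ, SepPrimes σ p q → ∀ x y : G, IsPElt p x → IsPElt q y → ⁅x, y⁆ ∈ S) :
    sigmaCommutator σ G ≤ S := by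
  rw [sigmaCommutator, Subgroup.closure_le]
  rintro _ ⟨p, q, x, y, hpq, hx, hy, rfl⟩
  exact h p q hpq x y hx hy

instance sigmaCommutator_normal : (sigmaCommutator σ G).Normal := by
  rw [← Subgroup.normalizer_eq_top_iff, eq_top_iff]
  refine normalizer_le_normalizer_closure ?_
  rintro b - _ ⟨p, q, x, y, hpq, hx, hy, rfl⟩
  refine ⟨p, q, _, _, hpq, hx.conj b, hy.conj b, ?_⟩
  simp only [commutatorElement_def]; group

theorem map_sigmaCommutator [Finite G] {f : G →* G'} (hf : Function.Surjective f) :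
    (sigmaCommutator σ G).map f = sigmaCommutator σ G' := by
  apply le_antisymm
  · rw [Subgroup.map_le_iff_le_comap]
    refine sigmaCommutator_le fun p q hpq x y hx hy => ?_
    rw [Subgroup.mem_comap, map_commutatorElement]
    exact commutator_mem_sigmaCommutator hpq (hx.map f) (hy.map f)
  · refine sigmaCommutator_le fun p q hpq x y hx hy => ?_
    obtain ⟨x, hx', rfl⟩ := hx.lift hpq.1 hf
    obtain ⟨y, hy', rfl⟩ := hy.lift hpq.2.1 hf
    rw [← map_commutatorElement]
    exact Subgroup.mem_map_of_mem f (commutator_mem_sigmaCommutator hpq hx' hy')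

theorem sigmaCommutator_eq_bot_iff : sigmaCommutator σ G = ⊥ ↔
    ∀ p q : ℕ, SepPrimes σ p q → ∀ x y : G, IsPElt p x → IsPElt q y → Commute x y := by
  constructor
  · intro h p q hpq x y hx hy
    have := commutator_mem_sigmaCommutator hpq hx hy
    rw [h, Subgroup.mem_bot] at this
    exact commutatorElement_eq_one_iff_commute.1 this
  · intro h
    rw [eq_bot_iff]
    exact sigmaCommutator_le fun p q hpq x y hx hy =>
      commutatorElement_eq_one_iff_commute.2 (h p q hpq x y hx hy)

/-- In each `σ`-primary coordinate one of two elements of separated prime power orders is trivial.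
-/
theorem IsSigmaNilpotent.sigmaCommutator_eq_bot [Finite G] (h : IsSigmaNilpotent σ G) :
    sigmaCommutator σ G = ⊥ := by
  obtain ⟨n, H, _, hH, ⟨e⟩⟩ := h
  have hfin : ∀ k, Finite (H k) := fun k =>
    Finite.of_surjective (fun g : G => e g k) fun y =>
      ⟨e.symm (Pi.mulSingle k y), by simp⟩
  rw [sigmaCommutator_eq_bot_iff]
  intro p q hpq x y hx hy
  have : Commute (e x) (e y) := by
    refine funext fun k => ?_
    obtain ⟨i, hi⟩ := hH k
    rw [isPiGroup_iff_forall_pElt] at hi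
    have hx' : IsPElt p (e x k) := hx.map ((Pi.evalMonoidHom H k).comp e.toMonoidHom)
    have hy' : IsPElt q (e y k) := hy.map ((Pi.evalMonoidHom H k).comp e.toMonoidHom)
    by_cases hpi : p ∈ σ i
    · simp [hi q hpq.2.1 (hpq.2.2 i hpi) _ hy']
    · simp [hi p hpq.1 hpi _ hx']
  exact e.injective (by simpa using this.eq)

theorem isSigmaNilpotent_of_sigmaCommutator_eq_bot {G : Type u} [Group G] [Finite G]
    (hσ : IsPrimePartition σ) (h : sigmaCommutator σ G = ⊥) : IsSigmaNilpotent σ G := by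
  classical
  rw [sigmaCommutator_eq_bot_iff] at h
  have hex : ∀ p : ℕ, p.Prime → ∃ i, p ∈ σ i := fun p hp => hσ.exists_mem hp
  have : Nonempty I := ⟨(hex 2 Nat.prime_two).choose⟩
  choose! c hc using hex
  -- Here c p is a class containing p. Only classes of primes dividing |G| are used, which keeps the
  -- product finite even if I is infinite.
  let J : Finset I := (Nat.card G).primeFactors.image c
  let e : Fin J.card ≃ J := J.equivFin.symm
  let H : Fin J.card → Subgroup G := fun k => piGen (σ (e k)) ⊤
  have hpi : ∀ k, IsPiGroup (σ (e k)) (H k) := fun k =>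
    isPiGroup_piGen fun p q hp hq hpi hqi x _ y _ hx hy =>
      h p q (hσ.sep hpi hq hqi) x y hx hy
  have hcomm : Pairwise fun k l => ∀ x y : G, x ∈ H k → y ∈ H l → Commute x y := by
    intro k l hkl x y hx hy
    have h1 : H k ≤ Subgroup.centralizer (H l) := by
      refine piGen_le fun p hp hpk z _ hz => ?_
      have : H l ≤ Subgroup.centralizer {z} := by
        refine piGen_le fun q hq hql w _ hw => ?_
        rw [Subgroup.mem_centralizer_singleton_iff]
        refine (h p q (hσ.sep hpk hq fun hqk => hkl ?_) z w hz hw).symm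
        exact e.injective (Subtype.ext (hσ.eq hqk hql))
      intro w hw
      exact Subgroup.mem_centralizer_singleton_iff.1 (this hw)
    exact ((h1 hx) y hy).symm
  have hco : Pairwise fun k l => Nat.Coprime (Nat.card (H k)) (Nat.card (H l)) := by
    intro k l hkl
    refine IsPiNumber.coprime (hpi k) fun p hp hpl hpk => hkl ?_
    exact e.injective (Subtype.ext (hσ.eq hpk (hpi l p hp hpl)))
  have hind : iSupIndep H := by
    have : ∀ k, Fintype (H k) := fun k => Fintype.ofFinite _
    refine Subgroup.independent_of_coprime_order hcomm fun k l hkl => ?_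
    simpa only [Nat.card_eq_fintype_card] using hco hkl
  refine ⟨J.card, fun k => H k, inferInstance, fun k => ⟨_, hpi k⟩, ⟨MulEquiv.symm ?_⟩⟩
  refine MulEquiv.ofBijective (Subgroup.noncommPiCoprod hcomm)
    ⟨Subgroup.injective_noncommPiCoprod_of_iSupIndep hind, ?_⟩
  rw [← MonoidHom.range_eq_top, Subgroup.noncommPiCoprod_range, eq_top_iff]
  refine le_of_pElt_mem fun p hp x _ hx => ?_
  by_cases hx1 : x = 1
  · rw [hx1]; exact Subgroup.one_mem _
  have hd : p ∣ Nat.card G := by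
    by_contra hd
    exact hx1 (hx.eq_one_of_not_dvd hp pow_card_eq_one' hd)
  have hJ : c p ∈ J := Finset.mem_image_of_mem c (Nat.mem_primeFactors.2 ⟨hp, hd, Nat.card_pos.ne'⟩)
  refine Subgroup.mem_iSup_of_mem (e.symm ⟨c p, hJ⟩) (mem_piGen hp ?_ (Subgroup.mem_top _) hx)
  simpa using hc p hp

theorem isSigmaNilpotent_iff {G : Type u} [Group G] [Finite G] (hσ : IsPrimePartition σ) :
    IsSigmaNilpotent σ G ↔ sigmaCommutator σ G = ⊥ :=
  ⟨fun h => h.sigmaCommutator_eq_bot, isSigmaNilpotent_of_sigmaCommutator_eq_bot hσ⟩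

/-- Since `sigmaCommutator` is carried onto `sigmaCommutator` by epimorphisms, G/N is `σ`-nilpotent
exactly when N contains it; so it is the least such N. -/
theorem sigmaNilpotentResidual_eq {G : Type u} [Group G] [Finite G] (hσ : IsPrimePartition σ) :
    sigmaNilpotentResidual σ G = sigmaCommutator σ G := by
  have key : ∀ N : Subgroup G, ∀ _ : N.Normal,
      (IsSigmaNilpotent σ (G ⧸ N) ↔ sigmaCommutator σ G ≤ N) := by
    intro N _
    rw [isSigmaNilpotent_iff hσ, ← map_sigmaCommutator (QuotientGroup.mk'_surjective N),
      Subgroup.map_eq_bot_iff, QuotientGroup.ker_mk']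
  apply le_antisymm
  · exact sInf_le ⟨inferInstance, (key _ inferInstance).2 le_rfl⟩
  · refine le_sInf ?_
    rintro N ⟨hN, h⟩
    exact (key N hN).1 h

/-- Modulo the `σ`-nilpotent residual, the `σ i`-elements generate a `σ i`-group. -/
theorem isPiNumber_relIndex_piGen_sup [Finite G] (hσ : IsPrimePartition σ) (i : I) :
    IsPiNumber (σ i) ((sigmaCommutator σ G).relIndex
      (piGen (σ i) (⊤ : Subgroup G) ⊔ sigmaCommutator σ G)) := by
  set D := sigmaCommutator σ G
  have hbot : sigmaCommutator σ (G ⧸ D) = ⊥ := by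
    rw [← map_sigmaCommutator (QuotientGroup.mk'_surjective D), Subgroup.map_eq_bot_iff,
      QuotientGroup.ker_mk']
  rw [sigmaCommutator_eq_bot_iff] at hbot
  have h := isPiGroup_piGen (π := σ i) (K := (⊤ : Subgroup (G ⧸ D)))
    fun p q hp hq hpi hqi x _ y _ hx hy => hbot p q (hσ.sep hpi hq hqi) x y hx hy
  rw [isPiGroup_coe_iff] at h
  refine isPiNumber_relIndex fun p hp hpi x hx hxp => ?_
  have hle : piGen (σ i) (⊤ : Subgroup G) ⊔ D ≤
      (piGen (σ i) (⊤ : Subgroup (G ⧸ D))).comap (QuotientGroup.mk' D) := by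
    refine sup_le (piGen_le fun q hq hqi y _ hy => ?_) fun y hy => ?_
    · exact mem_piGen hq hqi (Subgroup.mem_top _) (hy.map _)
    · rw [Subgroup.mem_comap, QuotientGroup.mk'_apply, (QuotientGroup.eq_one_iff y).2 hy]
      exact Subgroup.one_mem _
  have := h p hp hpi _ (hle hx) (hxp.map _)
  rwa [QuotientGroup.mk'_apply, QuotientGroup.eq_one_iff] at this

end Residual

/-! ### `σ`-soluble groups, Hall subgroups and permutability -/

section Soluble

variable {I : Type v} {σ : I → Set ℕ} {G : Type*} [Group G] {G' : Type*} [Group G']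

/-- Every nontrivial quotient of `G` has a nontrivial `σ`-primary normal subgroup. -/
def HasSigmaSeries (σ : I → Set ℕ) (G : Type*) [Group G] : Prop :=
  ∀ L : Subgroup G, L.Normal → L ≠ ⊤ →
    ∃ N : Subgroup G, N.Normal ∧ L < N ∧ ∃ i, IsPiNumber (σ i) (L.relIndex N)

theorem exists_minimal_normal_gt [Finite G] {L T : Subgroup G} (hT : T.Normal)
    (h : L < T) : ∃ N : Subgroup G, N.Normal ∧ L < N ∧ N ≤ T ∧
      ∀ M : Subgroup G, M.Normal → L < M → M ≤ N → M = N := by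
  obtain ⟨N, ⟨hN, hLN, hNT⟩, hmin⟩ :=
    WellFounded.has_min (wellFounded_lt (α := Subgroup G))
      {N | N.Normal ∧ L < N ∧ N ≤ T} ⟨T, hT, h, le_rfl⟩
  refine ⟨N, hN, hLN, hNT, fun M hM hLM hMN => ?_⟩
  by_contra hne
  exact hmin M ⟨hM, hLM, hMN.trans hNT⟩ (lt_of_le_of_ne hMN hne)

theorem IsSigmaSoluble.exists_isPiNumber [Finite G] (h : IsSigmaSoluble σ G) {L T : Subgroup G}
    (hL : L.Normal) (hT : T.Normal) (hLT : L < T) : ∃ N : Subgroup G, N.Normal ∧ L < N ∧ N ≤ T ∧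
      (∀ M : Subgroup G, M.Normal → L < M → M ≤ N → M = N) ∧
      ∃ i, IsPiNumber (σ i) (L.relIndex N) := by
  obtain ⟨N, hN, hLN, hNT, hmin⟩ := exists_minimal_normal_gt hT hLT
  refine ⟨N, hN, hLN, hNT, hmin, h N L ⟨hN, hL, hLN, fun M hM h1 h2 => ?_⟩⟩
  rcases h1.eq_or_lt with h1 | h1
  · exact Or.inl h1.symm
  · exact Or.inr (hmin M hM h1 h2)

theorem IsSigmaSoluble.hasSigmaSeries [Finite G] (h : IsSigmaSoluble σ G) :
    HasSigmaSeries σ G := by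
  intro L hL hne
  obtain ⟨N, hN, hLN, -, -, hi⟩ := h.exists_isPiNumber hL inferInstance hne.lt_top
  exact ⟨N, hN, hLN, hi⟩

theorem IsSigmaSoluble.of_surjective (h : IsSigmaSoluble σ G) {f : G →* G'}
    (hf : Function.Surjective f) : IsSigmaSoluble σ G' := by
  rintro H K ⟨hH, hK, hKH, hmin⟩
  have hc : IsChiefFactor (H.comap f) (K.comap f) := by
    refine ⟨hH.comap f, hK.comap f, (Subgroup.comap_lt_comap_of_surjective hf).2 hKH,
      fun N hN h1 h2 => ?_⟩
    have hk : f.ker ≤ N := le_trans (fun x hx => by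
      rw [Subgroup.mem_comap, (MonoidHom.mem_ker).1 hx]; exact K.one_mem) h1
    have hNe : (N.map f).comap f = N := Subgroup.comap_map_eq_self hk
    have := hmin (N.map f) (hN.map f hf)
      ((Subgroup.comap_le_comap_of_surjective hf).1 (by rwa [hNe]))
      ((Subgroup.comap_le_comap_of_surjective hf).1 (by rwa [hNe]))
    rw [← hNe]
    exact this.imp (congrArg _) (congrArg _)
  obtain ⟨i, hi⟩ := h _ _ hc
  refine ⟨i, fun p hp hd => hi p hp ?_⟩
  have : (K.comap f).relIndex (H.comap f) = K.relIndex H := by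
    rw [Subgroup.relIndex_comap, Subgroup.map_comap_eq_self_of_surjective hf]
  exact hd.trans (dvd_of_eq this.symm)

/-- Chief factors do not restrict to subgroups, but this weaker condition does. With N maximal
normal in G subject to N ∩ K ≤ L, the next term N' of G satisfies N' ∩ K ≰ L, and its `σ
i'`-elements in K lie in N ∩ K ≤ L. -/
theorem HasSigmaSeries.subgroup [Finite G] (h : HasSigmaSeries σ G) (K : Subgroup G) :
    HasSigmaSeries σ K := by
  intro L hL hne
  obtain ⟨N, ⟨hN, hNL⟩, hmax⟩ :=
    WellFounded.has_min (wellFounded_gt (α := Subgroup G))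
      {N | N.Normal ∧ N.subgroupOf K ≤ L} ⟨⊥, inferInstance, by simp⟩
  have hNt : N ≠ ⊤ := by
    rintro rfl
    exact hne (top_le_iff.1 (by simpa using hNL))
  obtain ⟨N', hN', hlt, i, hi⟩ := h N hN hNt
  refine ⟨L ⊔ N'.subgroupOf K, inferInstance, ?_, i, ?_⟩
  · refine lt_of_le_of_ne le_sup_left fun he => hmax N' ⟨hN', ?_⟩ hlt
    rw [he]; exact le_sup_right
  · rw [Subgroup.relIndex_sup_left]
    refine isPiNumber_relIndex fun p hp hpi x hx hxp => hNL ?_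
    exact Subgroup.mem_subgroupOf.2 (pElt_mem_of_isPiNumber_relIndex
      (by rw [Subgroup.normalizer_eq_top]; exact le_top) hi hp hpi
      (Subgroup.mem_subgroupOf.1 hx) hxp.coe)

/-- The Schur-Zassenhaus theorem for a section `N / L`. -/
theorem exists_relative_complement [Finite G] {L N : Subgroup G} [L.Normal] [N.Normal]
    (hLN : L ≤ N) (hc : Nat.Coprime (L.relIndex N) N.index) :
    ∃ S : Subgroup G, L ≤ S ∧ L.relIndex S = N.index ∧ S.index = L.relIndex N := by
  set f := QuotientGroup.mk' L
  have hf : Function.Surjective f := QuotientGroup.mk'_surjective L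
  have hcard : ∀ K : Subgroup G, Nat.card (K.map f) = L.relIndex K := by
    intro K
    rw [← Subgroup.relIndex_ker, QuotientGroup.ker_mk']
  have hNn : (N.map f).Normal := Subgroup.Normal.map inferInstance f hf
  have hidx : (N.map f).index = N.index :=
    Subgroup.index_map_eq N hf (by rw [QuotientGroup.ker_mk']; exact hLN)
  obtain ⟨S, hS⟩ := Subgroup.exists_right_complement'_of_coprime (N := N.map f)
    (by rw [hcard, hidx]; exact hc)
  refine ⟨S.comap f, fun x hx => ?_, ?_, ?_⟩
  · rw [Subgroup.mem_comap, show f x = 1 from (QuotientGroup.eq_one_iff x).2 hx]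
    exact S.one_mem
  · rw [← hcard, Subgroup.map_comap_eq_self_of_surjective hf, ← hS.symm.index_eq_card, hidx]
  · rw [Subgroup.index_comap_of_surjective _ hf, hS.index_eq_card, hcard]

/-- Hall subgroups of G/L are built by induction from the top. If N/L is a `σ i`-group, the full
preimage of the one for G/N works; otherwise N/L has order coprime to |T : N| and is complemented in
T/L by Schur-Zassenhaus. -/
theorem HasSigmaSeries.exists_isHallPi [Finite G] (hσ : IsPrimePartition σ)
    (h : HasSigmaSeries σ G) (i : I) : ∃ H : Subgroup G, IsHallPi (σ i) H := by
  suffices key : ∀ L : Subgroup G, L.Normal → ∃ T : Subgroup G, L ≤ T ∧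
      IsPiNumber (σ i) (L.relIndex T) ∧ ∀ p : ℕ, p.Prime → p ∣ T.index → p ∉ σ i by
    obtain ⟨T, -, h1, h2⟩ := key ⊥ inferInstance
    rw [Subgroup.relIndex_bot_left] at h1
    exact ⟨T, h1, h2⟩
  intro L
  induction L using WellFoundedGT.induction with
  | ind L ih =>
  intro hL
  by_cases hLt : L = ⊤
  · refine ⟨⊤, le_top, ?_, ?_⟩
    · intro p hp hd
      rw [hLt, Subgroup.relIndex_self] at hd
      exact absurd hd hp.not_dvd_one
    · intro p hp hd
      rw [Subgroup.index_top] at hd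
      exact absurd hd hp.not_dvd_one
  obtain ⟨N, hN, hLN, j, hj⟩ := h L hL hLt
  obtain ⟨T, hNT, h1, h2⟩ := ih N hLN hN
  by_cases hij : j = i
  · subst hij
    refine ⟨T, hLN.le.trans hNT, ?_, h2⟩
    rw [← Subgroup.relIndex_mul_relIndex _ _ _ hLN.le hNT]
    exact hj.mul h1
  have hr : (L.subgroupOf T).relIndex (N.subgroupOf T) = L.relIndex N :=
    Subgroup.relIndex_subgroupOf hNT
  have hnot : ∀ p : ℕ, p.Prime → p ∣ L.relIndex N → p ∉ σ i := fun p hp hd hpi =>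
    hij (hσ.eq (hj p hp hd) hpi)
  obtain ⟨S, hLS, hS1, hS2⟩ := exists_relative_complement (L := L.subgroupOf T)
    (N := N.subgroupOf T) (Subgroup.comap_mono hLN.le) (by
      rw [hr]
      exact (IsPiNumber.coprime (π := σ i) h1 hnot).symm)
  refine ⟨S.map T.subtype, ?_, ?_, ?_⟩
  · intro x hx
    exact ⟨⟨x, hNT (hLN.le hx)⟩, hLS (Subgroup.mem_subgroupOf.2 hx), rfl⟩
  · rw [← Subgroup.relIndex_comap]
    exact hS1 ▸ h1
  · intro p hp hd
    rw [Subgroup.index_map_subtype, hS2, hr, hp.dvd_mul] at hd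
    exact hd.elim (hnot p hp) (h2 p hp)

theorem IsHallPi.conj {π : Set ℕ} {H : Subgroup G} (h : IsHallPi π H) (g : G) :
    IsHallPi π (H.map (MulAut.conj g).toMonoidHom) := by
  refine ⟨fun p hp hd => h.1 p hp ?_, fun p hp hd => h.2 p hp ?_⟩
  · rwa [Subgroup.card_map_of_injective (MulAut.conj g).injective] at hd
  · have : (H.map (MulAut.conj g).toMonoidHom).index = H.index :=
      Subgroup.index_map_equiv H (MulAut.conj g)
    rwa [this] at hd

/-- A Sylow p-subgroup of H is one of G, so Sylow conjugacy suffices; no conjugacy of Hall subgroups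
is needed. -/
theorem IsHallPi.exists_conj_mem [Finite G] {π : Set ℕ} {H : Subgroup G} (h : IsHallPi π H) {p : ℕ}
    (hp : p.Prime) (hpπ : p ∈ π) {x : G} (hx : IsPElt p x) : ∃ g : G, g⁻¹ * x * g ∈ H := by
  have := Fact.mk hp
  obtain ⟨Q⟩ : Nonempty (Sylow p H) := inferInstance
  have hQ : ¬ p ∣ ((Q : Subgroup H).map H.subtype).index := by
    rw [Subgroup.index_map_subtype, hp.dvd_mul]
    rintro (hd | hd)
    · exact Q.not_dvd_index hd
    · exact h.2 p hp hd hpπ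
  obtain ⟨P, hP⟩ := hx.exists_sylow
  obtain ⟨g, hg⟩ := MulAction.exists_smul_eq G ((Q.isPGroup'.map H.subtype).toSylow hQ) P
  refine ⟨g, ?_⟩
  have hx' : x ∈ (P : Subgroup G) := hP
  rw [← hg, Sylow.coe_subgroup_smul, Subgroup.mem_pointwise_smul_iff_inv_smul_mem,
    IsPGroup.toSylow_coe] at hx'
  obtain ⟨y, -, hy⟩ := hx'
  have : (MulAut.conj g)⁻¹ • x = g⁻¹ * x * g := by
    rw [← map_inv, MulAut.smul_def, MulAut.conj_apply, inv_inv]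
  rw [← this, ← hy]
  exact y.2

theorem IsHallPi.exists_mem [Finite G] {π : Set ℕ} {H : Subgroup G} (h : IsHallPi π H) {p : ℕ}
    (hp : p.Prime) (hpπ : p ∈ π) {x : G} (hx : IsPElt p x) :
    ∃ K : Subgroup G, IsHallPi π K ∧ x ∈ K := by
  obtain ⟨g, hg⟩ := h.exists_conj_mem hp hpπ hx
  exact ⟨_, h.conj g, ⟨_, hg, by simp [mul_assoc]⟩⟩

theorem IsHallPi.eq_bot {i : I} {H : Subgroup G} [Finite G] (h : IsHallPi (σ i) H)
    (hi : ¬ MemSigma σ G i) : H = ⊥ := by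
  rw [← Subgroup.card_eq_one]
  by_contra hne
  obtain ⟨p, hp, hd⟩ := Nat.exists_prime_and_dvd hne
  exact hi ⟨p, h.1 p hp hd, hd.trans H.card_subgroup_dvd_card⟩

theorem permutes_of_normal {A B : Subgroup G} [A.Normal] : Permutes A B := by
  rw [Permutes, ← Subgroup.normal_mul, ← Subgroup.mul_normal, sup_comm]

theorem Permutes.symm {A B : Subgroup G} (h : Permutes A B) : Permutes B A := Eq.symm h

theorem Permutes.coe_sup {A B : Subgroup G} (h : Permutes A B) :
    ((A ⊔ B : Subgroup G) : Set G) = (A : Set G) * B := by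
  let S : Subgroup G :=
    { carrier := (A : Set G) * B
      one_mem' := ⟨1, A.one_mem, 1, B.one_mem, one_mul 1⟩
      mul_mem' := by
        intro x y hx hy
        obtain ⟨a, ha, b, hb, rfl⟩ := hx
        obtain ⟨c, hc, d, hd, rfl⟩ := hy
        have : b * c ∈ (B : Set G) * A := ⟨b, hb, c, hc, rfl⟩
        rw [← h] at this
        obtain ⟨c', hc', b', hb', he⟩ := this
        refine ⟨a * c', A.mul_mem ha hc', b' * d, B.mul_mem hb' hd, ?_⟩
        simp only at he ⊢
        rw [mul_assoc a c', ← mul_assoc c' b' d, he]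
        simp only [mul_assoc]
      inv_mem' := by
        rintro _ ⟨a, ha, b, hb, rfl⟩
        have : (a * b)⁻¹ ∈ (B : Set G) * A :=
          ⟨b⁻¹, B.inv_mem hb, a⁻¹, A.inv_mem ha, by simp⟩
        rwa [← h] at this }
  apply le_antisymm
  · have : A ⊔ B ≤ S := sup_le (fun a ha => ⟨a, ha, 1, B.one_mem, mul_one a⟩)
      fun b hb => ⟨1, A.one_mem, b, hb, one_mul b⟩
    exact this
  · rintro _ ⟨a, ha, b, hb, rfl⟩
    exact Subgroup.mul_mem_sup ha hb

theorem permutes_of_forall {A B : Subgroup G} (h : ∀ b ∈ B, ∀ a ∈ A, b * a ∈ (A : Set G) * B) :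
    Permutes A B := by
  apply Set.Subset.antisymm
  · rintro _ ⟨a, ha, b, hb, rfl⟩
    obtain ⟨a', ha', b', hb', hab⟩ := h b⁻¹ (B.inv_mem hb) a⁻¹ (A.inv_mem ha)
    refine ⟨b'⁻¹, B.inv_mem hb', a'⁻¹, A.inv_mem ha', ?_⟩
    have := congrArg (·⁻¹) hab
    simpa using this
  · rintro _ ⟨b, hb, a, ha, rfl⟩
    exact h b hb a ha

theorem permutes_of_le_normalizer {A B : Subgroup G}
    (h : B ≤ Subgroup.normalizer (A : Set G)) : Permutes A B :=
  permutes_of_forall fun b hb a ha =>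
    ⟨b * a * b⁻¹, (Subgroup.mem_normalizer_iff.1 (h hb) a).1 ha, b, hb, by simp⟩

theorem permutes_of_le {A B : Subgroup G} (h : A ≤ B) : Permutes A B :=
  (permutes_of_le_normalizer (h.trans Subgroup.le_normalizer)).symm

theorem Permutes.sup_left {A B H : Subgroup G} (hA : Permutes A H) (hB : Permutes B H) :
    Permutes (A ⊔ B) H := by
  refine Permutes.symm (permutes_of_forall fun x hx => ?_)
  have key : ∀ C : Subgroup G, C ≤ A ⊔ B → Permutes C H → ∀ x ∈ C, ∀ h ∈ H,
      x * h ∈ (H : Set G) * (A ⊔ B : Subgroup G) := by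
    intro C hC hp x hx h hh
    have : x * h ∈ (C : Set G) * H := ⟨x, hx, h, hh, rfl⟩
    rw [hp] at this
    exact Set.mul_subset_mul_left hC this
  rw [Subgroup.sup_eq_closure] at hx
  induction hx using Subgroup.closure_induction'' with
  | mem x hx =>
    exact hx.elim (key A le_sup_left hA x) (key B le_sup_right hB x)
  | inv_mem x hx =>
    exact hx.elim (fun hx => key A le_sup_left hA _ (A.inv_mem hx))
      (fun hx => key B le_sup_right hB _ (B.inv_mem hx))
  | one => exact fun h hh => ⟨h, hh, 1, Subgroup.one_mem _, by simp⟩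
  | mul x y _ _ ihx ihy =>
    intro h hh
    obtain ⟨h', hh', z, hz, hy⟩ := ihy h hh
    obtain ⟨h'', hh'', w, hw, hx⟩ := ihx h' hh'
    refine ⟨h'', hh'', w * z, Subgroup.mul_mem _ hw hz, ?_⟩
    simp only at hx hy ⊢
    rw [← mul_assoc, hx, mul_assoc, hy, mul_assoc]

theorem relIndex_eq_of_mul {A X Y : Subgroup G} (hY : Y ≤ X)
    (h : ∀ x ∈ X, ∃ y ∈ Y, ∃ a ∈ A, x = y * a) : A.relIndex Y = A.relIndex X := by
  refine Nat.card_congr (Equiv.ofBijective (Subgroup.quotientSubgroupOfEmbeddingOfLE A hY)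
    ⟨(Subgroup.quotientSubgroupOfEmbeddingOfLE A hY).injective, ?_⟩)
  intro q
  obtain ⟨⟨x, hx⟩, rfl⟩ := QuotientGroup.mk_surjective q
  obtain ⟨y, hy, a, ha, rfl⟩ := h x hx
  refine ⟨QuotientGroup.mk ⟨y, hy⟩, ?_⟩
  rw [Subgroup.quotientSubgroupOfEmbeddingOfLE_apply_mk]
  refine QuotientGroup.eq.2 ?_
  rw [Subgroup.mem_subgroupOf]
  simpa using ha

/-- If `A` permutes with a `σ j`-group `H`, then `A` contains `H ∩ N` for every overgroup `N` of
`A` whose index `|N : A|` is a `σ i`-number with `i ≠ j`. -/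
theorem Permutes.inf_le [Finite G] (hσ : IsPrimePartition σ) {A H N : Subgroup G} {i j : I}
    (hij : i ≠ j) (hAH : Permutes A H) (hAN : A ≤ N) (hH : IsPiGroup (σ j) H)
    (hi : IsPiNumber (σ i) (A.relIndex N)) : H ⊓ N ≤ A := by
  -- Dedekind's law: AH ∩ N = (H ∩ N)A. So the index of A ∩ H in H ∩ N divides both |N : A| and |H|,
  -- whose prime divisors lie in different classes.
  have h1 : A.relIndex (H ⊓ N) = A.relIndex ((A ⊔ H) ⊓ N) := by
    refine relIndex_eq_of_mul (inf_le_inf_right N le_sup_right) ?_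
    rintro x ⟨hx, hxN⟩
    have hx' : x ∈ (A : Set G) * H := by rw [← hAH.coe_sup]; exact hx
    rw [hAH] at hx'
    obtain ⟨h, hh, a, ha, rfl⟩ := hx'
    exact ⟨h, ⟨hh, by simpa using N.mul_mem hxN (N.inv_mem (hAN ha))⟩, a, ha, rfl⟩
  rw [← Subgroup.relIndex_eq_one]
  by_contra hne
  obtain ⟨p, hp, hd⟩ := Nat.exists_prime_and_dvd hne
  refine hij (hσ.eq (hi p hp ?_) (hH p hp ?_))
  · rw [h1] at hd
    refine hd.trans (Dvd.intro _ (Subgroup.relIndex_mul_relIndex A ((A ⊔ H) ⊓ N) N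
      (le_inf le_sup_left hAN) inf_le_right))
  · exact hd.trans ((Subgroup.relIndex_dvd_card _ _).trans (Subgroup.card_dvd_of_le inf_le_left))

/-- `A` permutes with all Hall `σ i`-subgroups. -/
def PermutesHalls (σ : I → Set ℕ) (A : Subgroup G) : Prop :=
  ∀ i, ∀ H : Subgroup G, IsHallPi (σ i) H → Permutes A H

theorem IsSigmaPermutable.permutesHalls [Finite G] {A : Subgroup G} (h : IsSigmaPermutable σ A) :
    PermutesHalls σ A := by
  intro i H hH
  rcases h with h | ⟨-, h⟩
  · exact permutes_of_normal
  · by_cases hi : MemSigma σ G i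
    · exact h i hi H hH
    · rw [hH.eq_bot hi]
      exact (permutes_of_le bot_le).symm

theorem HasSigmaSeries.isSigmaFull [Finite G] (hσ : IsPrimePartition σ)
    (h : HasSigmaSeries σ G) : IsSigmaFull σ G := fun i _ => h.exists_isHallPi hσ i

theorem PermutesHalls.isSigmaPermutable {A : Subgroup G} (h : PermutesHalls σ A)
    (hG : IsSigmaFull σ G) : IsSigmaPermutable σ A :=
  Or.inr ⟨hG, fun i _ H hH => h i H hH⟩

end Soluble

/-! ### `σ`-subnormal subgroups and Hall-permutable subgroups -/

section Subnormal

variable {I : Type v} {σ : I → Set ℕ} {G : Type*} [Group G] {G' : Type*} [Group G']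

/-- The core may be replaced by any C ≤ A normalised by B, since enlarging C only shrinks the index.
This form avoids nested subgroups and is stable under homomorphisms. -/
theorem sigmaSubnormalStep_iff {A B : Subgroup G} : SigmaSubnormalStep σ A B ↔
    A ≤ B ∧ (B ≤ Subgroup.normalizer (A : Set G) ∨ ∃ i, ∃ C ≤ A,
      B ≤ Subgroup.normalizer (C : Set G) ∧ IsPiNumber (σ i) (C.relIndex B)) := by
  refine and_congr_right fun hAB => or_congr (Subgroup.normal_subgroupOf_iff_le_normalizer hAB) ?_
  constructor
  · rintro ⟨i, hi⟩
    have hs : ((A.subgroupOf B).normalCore.map B.subtype).subgroupOf B =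
        (A.subgroupOf B).normalCore :=
      Subgroup.comap_map_eq_self_of_injective B.subtype_injective _
    refine ⟨i, (A.subgroupOf B).normalCore.map B.subtype, ?_, ?_, ?_⟩
    · rintro _ ⟨x, hx, rfl⟩
      exact Subgroup.mem_subgroupOf.1 (Subgroup.normalCore_le _ hx)
    · rw [← Subgroup.normal_subgroupOf_iff_le_normalizer (Subgroup.map_subtype_le _), hs]
      infer_instance
    · rw [Subgroup.relIndex, hs]
      exact hi
  · rintro ⟨i, C, hCA, hBC, hi⟩
    refine ⟨i, fun p hp hd => hi p hp (hd.trans ?_)⟩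
    have hn : (C.subgroupOf B).Normal :=
      (Subgroup.normal_subgroupOf_iff_le_normalizer (hCA.trans hAB)).2 hBC
    exact Subgroup.index_dvd_of_le (Subgroup.normal_le_normalCore.2 (Subgroup.comap_mono hCA))

theorem isPiNumber_relIndex_map [Finite G] [Finite G'] {π : Set ℕ} (f : G →* G') {B C : Subgroup G}
    (hBC : B ≤ Subgroup.normalizer (C : Set G)) (h : IsPiNumber π (C.relIndex B)) :
    IsPiNumber π ((C.map f).relIndex (B.map f)) := by
  refine isPiNumber_relIndex fun p hp hpπ y hy hyp => ?_
  obtain ⟨x, hxp, hx⟩ := (IsPElt.of_coe (x := ⟨y, hy⟩) hyp).lift hp (f.subgroupMap_surjective B)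
  exact ⟨x, pElt_mem_of_isPiNumber_relIndex hBC h hp hpπ x.2 hxp.coe, congrArg Subtype.val hx⟩

theorem SigmaSubnormalStep.map [Finite G] [Finite G'] {A B : Subgroup G}
    (h : SigmaSubnormalStep σ A B) (f : G →* G') : SigmaSubnormalStep σ (A.map f) (B.map f) := by
  rw [sigmaSubnormalStep_iff] at h ⊢
  have hn : ∀ C : Subgroup G, B ≤ Subgroup.normalizer (C : Set G) →
      B.map f ≤ Subgroup.normalizer (C.map f : Set G') := by
    intro C hC
    refine normalizer_le_of_conj_mem ?_
    rintro _ ⟨b, hb, rfl⟩ _ ⟨c, hc, rfl⟩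
    exact ⟨b * c * b⁻¹, (Subgroup.mem_normalizer_iff.1 (hC hb) c).1 hc, by simp⟩
  refine ⟨Subgroup.map_mono h.1, h.2.imp (hn A) ?_⟩
  rintro ⟨i, C, hCA, hBC, hi⟩
  exact ⟨i, C.map f, Subgroup.map_mono hCA, hn C hBC, isPiNumber_relIndex_map f hBC hi⟩

theorem reflTransGen_map [Finite G] [Finite G'] {A B : Subgroup G}
    (h : Relation.ReflTransGen (SigmaSubnormalStep σ) A B) (f : G →* G') :
    Relation.ReflTransGen (SigmaSubnormalStep σ) (A.map f) (B.map f) :=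
  Relation.ReflTransGen.lift (Subgroup.map f) (fun _ _ h => h.map f) _ _ h

theorem IsSigmaSubnormal.map_of_surjective [Finite G] [Finite G'] {A : Subgroup G}
    (h : IsSigmaSubnormal σ A) {f : G →* G'} (hf : Function.Surjective f) : IsSigmaSubnormal σ (A.map f) := by
  have := reflTransGen_map h f
  rwa [← MonoidHom.range_eq_map, MonoidHom.range_eq_top.2 hf] at this

theorem IsSigmaSubnormal.map_subtype [Finite G] {K : Subgroup G} {A : Subgroup K}
    (h : IsSigmaSubnormal σ A) (hK : IsSigmaSubnormal σ K) :
    IsSigmaSubnormal σ (A.map K.subtype) := by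
  have := reflTransGen_map h K.subtype
  rw [← MonoidHom.range_eq_map, K.range_subtype] at this
  exact this.trans hK

theorem IsSigmaSubnormal.of_normalizer {A B : Subgroup G} (hB : IsSigmaSubnormal σ B)
    (hAB : A ≤ B) (h : B ≤ Subgroup.normalizer (A : Set G)) : IsSigmaSubnormal σ A :=
  Relation.ReflTransGen.head (sigmaSubnormalStep_iff.2 ⟨hAB, Or.inl h⟩) hB

theorem isSigmaSubnormal_of_normal {A : Subgroup G} [A.Normal] : IsSigmaSubnormal σ A :=
  IsSigmaSubnormal.of_normalizer Relation.ReflTransGen.refl le_top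
    (by rw [Subgroup.normalizer_eq_top])

/-- The subgroup of B generated by its `σ i'`-elements is normal in B with `σ i`-index. It lies in
A, because each generator lies in a Hall subgroup K for another class, and K ∩ B ≤ A by
`Permutes.inf_le`. -/
theorem PermutesHalls.step [Finite G] (hσ : IsPrimePartition σ) (hG : HasSigmaSeries σ G)
    {A B : Subgroup G} (hA : PermutesHalls σ A) (hAB : A ≤ B) {i : I}
    (hi : IsPiNumber (σ i) (A.relIndex B)) : SigmaSubnormalStep σ A B := by
  rw [sigmaSubnormalStep_iff]
  refine ⟨hAB, Or.inr ⟨i, piGen (σ i)ᶜ B, piGen_le fun p hp hpi x hx hxp => ?_,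
    normalizer_le_normalizer_piGen Subgroup.le_normalizer,
    isPiNumber_relIndex fun p hp hpi x hx hxp => mem_piGen hp hpi hx hxp⟩⟩
  obtain ⟨j, hj⟩ := hσ.exists_mem hp
  obtain ⟨H, hH⟩ := hG.exists_isHallPi hσ j
  obtain ⟨K, hK, hxK⟩ := hH.exists_mem hp hj hxp
  exact (hA j K hK).inf_le hσ (by rintro rfl; exact hpi hj) hAB hK.1 hi ⟨hxK, hx⟩

/-- A subgroup permuting with all Hall `σ i`-subgroups of a `σ`-soluble group is
`σ`-subnormal. -/
theorem PermutesHalls.isSigmaSubnormal [Finite G] (hσ : IsPrimePartition σ)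
    (hG : HasSigmaSeries σ G) {A : Subgroup G} (hA : PermutesHalls σ A) :
    IsSigmaSubnormal σ A := by
  suffices key : ∀ L : Subgroup G, L.Normal → IsSigmaSubnormal σ (A ⊔ L) by
    simpa using key ⊥ inferInstance
  intro L
  induction L using WellFoundedGT.induction with
  | ind L ih =>
  intro hL
  by_cases hLt : L = ⊤
  · rw [hLt, sup_top_eq]; exact Relation.ReflTransGen.refl
  obtain ⟨N, hN, hLN, i, hi⟩ := hG L hL hLt
  refine Relation.ReflTransGen.head ?_ (ih N hLN hN)
  have hAL : PermutesHalls σ (A ⊔ L) := fun j H hH => (hA j H hH).sup_left permutes_of_normal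
  refine hAL.step hσ hG (i := i) (sup_le_sup_left hLN.le A) (IsPiNumber.of_dvd hi ?_)
  have : (A ⊔ L).relIndex N = (A ⊔ L).relIndex (A ⊔ N) := by
    refine relIndex_eq_of_mul le_sup_right fun x hx => ?_
    rw [sup_comm, ← SetLike.mem_coe, Subgroup.normal_mul] at hx
    obtain ⟨n, hn, a, ha, rfl⟩ := hx
    exact ⟨n, hn, a, Subgroup.mem_sup_left ha, rfl⟩
  rw [← this]
  exact Subgroup.relIndex_dvd_of_le_left _ le_sup_right

/-- Transitivity is borrowed from `σ`-subnormality: both given permutabilities become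
`σ`-subnormality, inside K and inside G, and the composite is turned back by `h`. -/
theorem isPSigmaTGroup_of_permutesHalls [Finite G] (hσ : IsPrimePartition σ)
    (hG : HasSigmaSeries σ G) (h : ∀ A : Subgroup G, IsSigmaSubnormal σ A → PermutesHalls σ A) :
    IsPSigmaTGroup σ G := by
  intro K H hH hK
  refine (h _ ?_).isSigmaPermutable (hG.isSigmaFull hσ)
  exact (hH.permutesHalls.isSigmaSubnormal hσ (hG.subgroup K)).map_subtype
    (hK.permutesHalls.isSigmaSubnormal hσ hG)

end Subnormal

/-! ### Power automorphisms of coprime order and without fixed points -/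

section PowerAction

variable {G : Type*} [Group G]

theorem IsPElt.mem_of_pow_mem {q : ℕ} {g : G} (hg : IsPElt q g) {m : ℕ} (hm : Nat.Coprime q m)
    {S : Subgroup G} (h : g ^ m ∈ S) : g ∈ S := by
  obtain ⟨l, hl⟩ := hg
  have hbz : ((q ^ l : ℕ) : ℤ) * (q ^ l).gcdA m + m * (q ^ l).gcdB m = 1 := by
    rw [← Nat.gcd_eq_gcd_ab]; exact_mod_cast hm.pow_left l
  have : g = (g ^ m) ^ ((q ^ l).gcdB m) := by
    conv_lhs => rw [← zpow_one g, ← hbz, zpow_add, zpow_mul, zpow_natCast, hl, one_zpow, one_mul,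
      zpow_mul, zpow_natCast]
  rw [this]
  exact S.zpow_mem h _

theorem conj_zpow_eq (g x : G) (n : ℤ) : g * x ^ n * g⁻¹ = (g * x * g⁻¹) ^ n := by
  rw [conj_zpow]

theorem zpow_eq_self_of_dvd {p : ℕ} {x : G} (hx : x ^ p = 1) {m : ℤ} (h : (p : ℤ) ∣ m - 1) :
    x ^ m = x := by
  obtain ⟨c, hc⟩ := h
  rw [show m = p * c + 1 by omega, zpow_add_one, zpow_mul, zpow_natCast, hx, one_zpow, one_mul]

theorem dvd_of_zpow_eq_self {p : ℕ} (hp : p.Prime) {x : G} (hx : x ^ p = 1) (hx1 : x ≠ 1) {m : ℤ}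
    (h : x ^ m = x) : (p : ℤ) ∣ m - 1 := by
  rw [← orderOf_eq_prime hx hx1 (hp := ⟨hp⟩), orderOf_dvd_iff_zpow_eq_one, zpow_sub_one, h,
    mul_inv_cancel]

/-- If `g` acts as a power on two commuting elements of order `p` and on their product, then it
acts on both as the same power. -/
theorem exists_common_zpow {p : ℕ} (hp : p.Prime) {g x z : G} (hxz : Commute x z) (hx : x ^ p = 1)
    (hgx : g * x * g⁻¹ ∈ Subgroup.zpowers x)
    (hgz : g * z * g⁻¹ ∈ Subgroup.zpowers z)
    (hgxz : g * (x * z) * g⁻¹ ∈ Subgroup.zpowers (x * z)) :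
    ∃ m : ℤ, g * x * g⁻¹ = x ^ m ∧ g * z * g⁻¹ = z ^ m := by
  obtain ⟨n, hn⟩ := hgx
  obtain ⟨k, hk⟩ := hgz
  obtain ⟨m, hm⟩ := hgxz
  simp only at hn hk hm
  have h1 : x ^ m * z ^ m = x ^ n * z ^ k := by
    rw [← hxz.mul_zpow, hm, hn, hk]; group
  have h2 : x ^ (m - n) = z ^ (k - m) := by
    rw [sub_eq_neg_add, zpow_add, zpow_sub, eq_mul_inv_iff_mul_eq, mul_assoc, h1, ← mul_assoc,
      ← zpow_add]
    simp
  -- If this power is nontrivial, it generates the group of order p spanned by x, so x is a power of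
  -- z and inherits its exponent k.
  by_cases h : x ^ (m - n) = 1
  · refine ⟨m, ?_, ?_⟩
    · rw [← hn]; rw [zpow_sub, mul_inv_eq_one] at h; exact h.symm
    · rw [h2, zpow_sub, mul_inv_eq_one] at h; rw [← hk, h]
  · have hxp : IsPElt p x := ⟨1, by simpa using hx⟩
    have hc : ¬ (p : ℤ) ∣ m - n := by
      rintro ⟨c, hc⟩
      exact h (by rw [hc, zpow_mul, zpow_natCast, hx, one_zpow])
    have hmem : x ∈ Subgroup.zpowers z := by
      have hcop : Nat.Coprime p (m - n).natAbs := by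
        rw [hp.coprime_iff_not_dvd]
        rwa [Int.natCast_dvd] at hc
      refine hxp.mem_of_pow_mem hcop ?_
      have : x ^ (m - n) ∈ Subgroup.zpowers z := by
        rw [h2]; exact Subgroup.zpow_mem _ (Subgroup.mem_zpowers z) _
      rcases Int.natAbs_eq (m - n) with he | he
      · rw [he, zpow_natCast] at this; exact this
      · rw [he, zpow_neg, zpow_natCast] at this; simpa using this
    obtain ⟨s, rfl⟩ := hmem
    refine ⟨k, ?_, hk.symm⟩
    simp only
    rw [conj_zpow_eq, ← hk, ← zpow_mul, ← zpow_mul, mul_comm]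

theorem commute_of_common {p : ℕ} (hp : p.Prime) {g x z : G} (hxz : Commute x z) (hx : x ^ p = 1)
    (hz : z ^ p = 1) (hz1 : z ≠ 1) (hgx : g * x * g⁻¹ ∈ Subgroup.zpowers x)
    (hgxz : g * (x * z) * g⁻¹ ∈ Subgroup.zpowers (x * z)) (hc : Commute g z) : Commute g x := by
  have hgz : g * z * g⁻¹ = z := by rw [hc.eq, mul_inv_cancel_right]
  obtain ⟨m, h1, h2⟩ := exists_common_zpow hp hxz hx hgx
    (by rw [hgz]; exact Subgroup.mem_zpowers z) hgxz
  rw [hgz] at h2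
  have := zpow_eq_self_of_dvd hx (dvd_of_zpow_eq_self hp hz hz1 h2.symm)
  rw [this] at h1
  exact mul_inv_eq_iff_eq_mul.1 h1

theorem conj_pow_zpow_iterate {g y : G} {n : ℤ} (h : g * y * g⁻¹ = y ^ n) (r : ℕ) :
    g ^ r * y * (g ^ r)⁻¹ = y ^ (n ^ r) := by
  induction r with
  | zero => simp
  | succ r ih =>
    have : g ^ (r + 1) * y * (g ^ (r + 1))⁻¹ = g * (g ^ r * y * (g ^ r)⁻¹) * g⁻¹ := by
      rw [pow_succ']; group
    rw [this, ih, conj_zpow_eq, h, ← zpow_mul, pow_succ']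

/-- A `p'`-element acting as a power on the `p`-element `y` and centralising its power of order
`p` centralises `y`. -/
theorem commute_of_commute_pow {p q : ℕ} (hp : p.Prime) (hq : q.Prime) (hpq : p ≠ q) {g y : G}
    (hg : IsPElt q g) {k : ℕ} (hy : y ^ p ^ (k + 1) = 1) (hy1 : y ^ p ^ k ≠ 1)
    (hgy : g * y * g⁻¹ ∈ Subgroup.zpowers y) (hc : Commute g (y ^ p ^ k)) : Commute g y := by
  obtain ⟨n, hn⟩ := hgy
  simp only at hn
  have hz : (y ^ p ^ k) ^ p = 1 := by rw [← pow_mul, ← pow_succ, hy]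
  have hzn : (y ^ p ^ k) ^ n = y ^ p ^ k := by
    have : g * y ^ p ^ k * g⁻¹ = y ^ p ^ k := by rw [hc.eq, mul_inv_cancel_right]
    rw [← conj_pow, ← hn, ← zpow_natCast, ← zpow_mul, mul_comm, zpow_mul, zpow_natCast] at this
    exact this
  have hd := dvd_of_zpow_eq_self hp hz hy1 hzn
  -- As n is 1 modulo p, its `p ^ k`-th power is 1 modulo `p ^ (k + 1)`. Thus `g ^ p ^ k`
  -- centralises y, and so does g, whose order is prime to p.
  have hd' := dvd_sub_pow_of_dvd_sub hd k
  rw [one_pow] at hd'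
  have h1 : y ^ (n ^ p ^ k) = y := by
    refine zpow_eq_self_of_dvd hy ?_
    exact_mod_cast hd'
  have h2 : g ^ p ^ k ∈ Subgroup.centralizer {y} := by
    rw [Subgroup.mem_centralizer_singleton_iff]
    have := conj_pow_zpow_iterate hn.symm (p ^ k)
    rw [h1] at this
    exact mul_inv_eq_iff_eq_mul.1 this
  have h3 := hg.mem_of_pow_mem (Nat.Coprime.pow_right k ((Nat.coprime_primes hq hp).2 hpq.symm)) h2
  exact Subgroup.mem_centralizer_singleton_iff.1 h3

/-- A nontrivial `p`-element has a power of order `p`. -/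
theorem IsPElt.exists_pow_order {p : ℕ} {y : G} (h : IsPElt p y) (hy : y ≠ 1) :
    ∃ k : ℕ, y ^ p ^ (k + 1) = 1 ∧ y ^ p ^ k ≠ 1 := by
  classical
  have hf := Nat.find_spec h
  have hmin := fun m => Nat.find_min (m := m) h
  rcases hk : Nat.find h with _ | k
  · rw [hk] at hf; exact absurd (by simpa using hf) hy
  · exact ⟨k, hk ▸ hf, hmin k (by omega)⟩

/-- A `p'`-element inducing a power automorphism on a `p`-group and centralising a nontrivial
element centralises the whole group. -/
theorem commute_of_power_of_commute [Finite G] {p q : ℕ} (hp : p.Prime) (hq : q.Prime)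
    (hpq : p ≠ q) {g : G} (hg : IsPElt q g) {P : Subgroup G} (hP : IsPGroup p P)
    (hgP : ∀ x ∈ P, g * x * g⁻¹ ∈ Subgroup.zpowers x) {x : G} (hx : x ∈ P) (hx1 : x ≠ 1)
    (hgx : Commute g x) {y : G} (hy : y ∈ P) : Commute g y := by
  have := Fact.mk hp
  have hel : ∀ z ∈ P, IsPElt p z := fun z hz => by
    obtain ⟨k, hk⟩ := hP ⟨z, hz⟩
    exact ⟨k, by simpa using congrArg Subtype.val hk⟩
  have : Nontrivial P := ⟨⟨x, hx⟩, 1, by simpa [Subtype.ext_iff] using hx1⟩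
  have := hP.center_nontrivial
  obtain ⟨⟨⟨w, hwP⟩, hwc⟩, hw1⟩ := exists_ne (1 : Subgroup.center P)
  have hw1' : w ≠ 1 := by
    rintro rfl; exact hw1 rfl
  have hwcomm : ∀ z ∈ P, Commute z w := fun z hz =>
    congrArg Subtype.val (Subgroup.mem_center_iff.1 hwc ⟨z, hz⟩)
  obtain ⟨k, hk1, hk2⟩ := (hel w hwP).exists_pow_order hw1'
  obtain ⟨l, hl1, hl2⟩ := (hel x hx).exists_pow_order hx1
  -- A central element of order p serves as a bridge: it commutes with both x and y, so being
  -- centralised by g passes from x to it and from it to the power of y of order p.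
  have hgw : Commute g (w ^ p ^ k) := by
    have hmem := P.pow_mem hwP (p ^ k)
    have hmem' := P.pow_mem hx (p ^ l)
    refine commute_of_common hp (z := x ^ p ^ l) ((hwcomm x hx).symm.pow_pow _ _)
      (by rw [← pow_mul, ← pow_succ, hk1]) (by rw [← pow_mul, ← pow_succ, hl1]) hl2
      (hgP _ hmem) (hgP _ (P.mul_mem hmem hmem')) (hgx.pow_right _)
  by_cases hy1 : y = 1
  · rw [hy1]; exact Commute.one_right g
  obtain ⟨m, hm1, hm2⟩ := (hel y hy).exists_pow_order hy1
  refine commute_of_commute_pow hp hq hpq hg hm1 hm2 (hgP y hy) ?_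
  have hmem := P.pow_mem hwP (p ^ k)
  have hmem' := P.pow_mem hy (p ^ m)
  exact commute_of_common hp ((hwcomm y hy).pow_pow _ _) (by rw [← pow_mul, ← pow_succ, hm1])
    (by rw [← pow_mul, ← pow_succ, hk1]) hk2 (hgP _ hmem') (hgP _ (P.mul_mem hmem' hmem)) hgw

/-- If `g` induces a power automorphism on `P`, then `y⁻¹ * (g * y * g⁻¹)` normalises every cyclic
subgroup of `P`, for every `y ∈ P`. -/
theorem inv_mul_conj_mem_normalizer [Finite G] {g : G} {P : Subgroup G}
    (hgP : ∀ x ∈ P, g * x * g⁻¹ ∈ Subgroup.zpowers x) {x y : G} (hx : x ∈ P) (hy : y ∈ P) :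
    y⁻¹ * (g * y * g⁻¹) ∈ Subgroup.normalizer (Subgroup.zpowers x : Set G) := by
  have hg : ∀ z ∈ P, g ∈ Subgroup.normalizer (Subgroup.zpowers z : Set G) := by
    intro z hz
    have hle : (Subgroup.zpowers z).map (MulAut.conj g).toMonoidHom ≤ Subgroup.zpowers z := by
      rw [MonoidHom.map_zpowers, Subgroup.zpowers_le]
      simpa using hgP z hz
    have heq : (Subgroup.zpowers z).map (MulAut.conj g).toMonoidHom = Subgroup.zpowers z :=
      Subgroup.eq_of_le_of_card_ge hle
        (by rw [Subgroup.card_map_of_injective (MulAut.conj g).injective])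
    rw [Subgroup.mem_normalizer_iff]
    intro w
    constructor
    · intro hw
      rw [← heq]
      exact ⟨w, hw, by simp⟩
    · intro hw
      rw [← heq] at hw
      obtain ⟨u, hu, huw⟩ := hw
      have : u = w := by simpa using huw
      exact this ▸ hu
  -- Since g normalises the cyclic groups of x and of `y * x * y⁻¹`, both g and `y⁻¹ * g * y`
  -- normalise that of x; the element in question is a quotient of these two.
  have hyx : y * x * y⁻¹ ∈ P := P.mul_mem (P.mul_mem hy hx) (P.inv_mem hy)
  have h1 := hg _ hyx
  have h2 := hg x hx
  have hconj : ∀ w, w ∈ Subgroup.zpowers (y * x * y⁻¹) ↔ y⁻¹ * w * y ∈ Subgroup.zpowers x := by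
    intro w
    constructor
    · rintro ⟨n, rfl⟩
      exact ⟨n, by simp only; rw [conj_zpow]; group⟩
    · rintro ⟨n, hn⟩
      refine ⟨n, ?_⟩
      simp only at hn ⊢
      rw [conj_zpow, hn]; group
  rw [Subgroup.mem_normalizer_iff] at h1 h2 ⊢
  intro w
  have e1 := h2 (g⁻¹ * w * g)
  have e2 := hconj (y * (g⁻¹ * w * g) * y⁻¹)
  have e3 := h1 (y * (g⁻¹ * w * g) * y⁻¹)
  have e4 := hconj (g * (y * (g⁻¹ * w * g) * y⁻¹) * g⁻¹)
  rw [show g * (g⁻¹ * w * g) * g⁻¹ = w by group] at e1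
  rw [show y⁻¹ * (y * (g⁻¹ * w * g) * y⁻¹) * y = g⁻¹ * w * g by group] at e2
  rw [show y⁻¹ * (g * (y * (g⁻¹ * w * g) * y⁻¹) * g⁻¹) * y =
    y⁻¹ * (g * y * g⁻¹) * w * (y⁻¹ * (g * y * g⁻¹))⁻¹ by group] at e4
  exact e1.symm.trans (e2.symm.trans (e3.trans e4))

/-- The map y ↦ y⁻¹(gyg⁻¹) on the finite set P is injective, since two elements y, z with equal
images give a fixed point zy⁻¹. -/
theorem inv_mul_conj_surj [Finite G] {g : G} {P : Subgroup G}
    (hgP : ∀ x ∈ P, g * x * g⁻¹ ∈ P) (hfix : ∀ x ∈ P, Commute g x → x = 1) {x : G} (hx : x ∈ P) :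
    ∃ y ∈ P, y⁻¹ * (g * y * g⁻¹) = x := by
  let φ : P → P := fun y => ⟨y⁻¹ * (g * y * g⁻¹), P.mul_mem (P.inv_mem y.2) (hgP y y.2)⟩
  have hinj : Function.Injective φ := by
    rintro ⟨y, hy⟩ ⟨z, hz⟩ h
    have h' : y⁻¹ * (g * y * g⁻¹) = z⁻¹ * (g * z * g⁻¹) := congrArg Subtype.val h
    have hc : Commute g (z * y⁻¹) := by
      have : g * (z * y⁻¹) * g⁻¹ = z * y⁻¹ := by
        have e1 : g * (z * y⁻¹) * g⁻¹ = (g * z * g⁻¹) * (g * y * g⁻¹)⁻¹ := by group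
        have e2 : g * z * g⁻¹ = z * (y⁻¹ * (g * y * g⁻¹)) := by rw [h']; group
        rw [e1, e2]; group
      exact mul_inv_eq_iff_eq_mul.1 this
    have := hfix _ (P.mul_mem hz (P.inv_mem hy)) hc
    exact Subtype.ext (mul_inv_eq_one.1 this).symm
  obtain ⟨⟨y, hy⟩, h⟩ := Finite.surjective_of_injective hinj ⟨x, hx⟩
  exact ⟨y, hy, congrArg Subtype.val h⟩

theorem commutator_zpow_zpow {x y : G} (hx : Commute ⁅x, y⁆ x) (hy : Commute ⁅x, y⁆ y) (n m : ℤ) :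
    ⁅x ^ n, y ^ m⁆ = ⁅x, y⁆ ^ (m * n) := by
  have h1 : x * y ^ m * x⁻¹ = ⁅x, y⁆ ^ m * y ^ m := by
    rw [← hy.mul_zpow, conj_zpow_eq, commutatorElement_def]; congr 1; group
  have h2 : y ^ m * x * (y ^ m)⁻¹ = (⁅x, y⁆ ^ m)⁻¹ * x := by
    have e : x * y ^ m = ⁅x, y⁆ ^ m * y ^ m * x := mul_inv_eq_iff_eq_mul.1 h1
    have e2 : (⁅x, y⁆ ^ m)⁻¹ * x * y ^ m = y ^ m * x := by rw [mul_assoc, e]; group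
    rw [← e2]; group
  have h3 : y ^ m * x ^ n * (y ^ m)⁻¹ = ((⁅x, y⁆ ^ m)⁻¹) ^ n * x ^ n := by
    rw [conj_zpow_eq, h2, ((hx.zpow_left m).inv_left).mul_zpow]
  have h4 : ⁅x ^ n, y ^ m⁆ = x ^ n * (y ^ m * x ^ n * (y ^ m)⁻¹)⁻¹ := by
    rw [commutatorElement_def]; group
  rw [h4, h3, mul_inv_rev, ← mul_assoc, mul_inv_cancel, one_mul, inv_zpow, inv_inv, zpow_mul]

/-- A group with a fixed point free power automorphism is abelian. -/
theorem commute_of_power_of_fixedPointFree [Finite G] {g : G} {P : Subgroup G}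
    (hgP : ∀ x ∈ P, g * x * g⁻¹ ∈ Subgroup.zpowers x) (hfix : ∀ x ∈ P, Commute g x → x = 1)
    {x y : G} (hx : x ∈ P) (hy : y ∈ P) : Commute x y := by
  have hnorm : ∀ z ∈ P, ∀ w ∈ P, z ∈ Subgroup.normalizer (Subgroup.zpowers w : Set G) := by
    intro z hz w hw
    obtain ⟨u, hu, rfl⟩ := inv_mul_conj_surj
      (fun x hx => (Subgroup.zpowers_le.2 hx) (hgP x hx)) hfix hz
    exact inv_mul_conj_mem_normalizer hgP hw hu
  have hcy : ⁅x, y⁆ ∈ Subgroup.zpowers y := by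
    rw [commutatorElement_def]
    exact Subgroup.mul_mem _ ((Subgroup.mem_normalizer_iff.1 (hnorm x hx y hy) y).1
      (Subgroup.mem_zpowers y)) (Subgroup.inv_mem _ (Subgroup.mem_zpowers y))
  have hcx : ⁅x, y⁆ ∈ Subgroup.zpowers x := by
    rw [commutatorElement_def, mul_assoc, mul_assoc, ← mul_assoc y]
    exact Subgroup.mul_mem _ (Subgroup.mem_zpowers x)
      ((Subgroup.mem_normalizer_iff.1 (hnorm y hy x hx) x⁻¹).1
        (Subgroup.inv_mem _ (Subgroup.mem_zpowers x)))
  have hcommx : Commute ⁅x, y⁆ x := by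
    obtain ⟨s, hs⟩ := hcx
    simp only at hs
    rw [← hs]; exact (Commute.refl x).zpow_left s
  have hcommy : Commute ⁅x, y⁆ y := by
    obtain ⟨s, hs⟩ := hcy
    simp only at hs
    rw [← hs]; exact (Commute.refl y).zpow_left s
  obtain ⟨n, hn⟩ := hgP x hx
  obtain ⟨m, hm⟩ := hgP y hy
  simp only at hn hm
  have hpow : ∀ z c : G, ∀ k : ℤ, g * z * g⁻¹ = z ^ k → c ∈ Subgroup.zpowers z →
      g * c * g⁻¹ = c ^ k := by
    rintro z _ k hk ⟨s, rfl⟩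
    simp only
    rw [conj_zpow_eq, hk, ← zpow_mul, ← zpow_mul, mul_comm]
  have e1 := hpow x _ n hn.symm hcx
  have e2 := hpow y _ m hm.symm hcy
  have e3 : g * ⁅x, y⁆ * g⁻¹ = ⁅x, y⁆ ^ (m * n) := by
    rw [← commutator_zpow_zpow hcommx hcommy, hn, hm]
    simp only [commutatorElement_def]; group
  set c := ⁅x, y⁆ with hcdef
  -- Conjugation by g acts on c as the n-th power, as the m-th power, and as the mn-th power. So c
  -- and its conjugate by g have the same conjugate, and c is a fixed point.
  have e4 : g * (g * c * g⁻¹) * g⁻¹ = g * c * g⁻¹ := by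
    calc g * (g * c * g⁻¹) * g⁻¹ = (g * c * g⁻¹) ^ n := by rw [← conj_zpow_eq, e1]
      _ = c ^ (m * n) := by rw [e2, zpow_mul]
      _ = g * c * g⁻¹ := e3.symm
  have e5 : Commute g c := by
    have : g * c * g⁻¹ = c := by simpa using e4
    exact mul_inv_eq_iff_eq_mul.1 this
  have hcP : c ∈ P := Subgroup.zpowers_le.2 hx hcx
  exact commutatorElement_eq_one_iff_commute.1 (hfix c hcP e5)

/-- The product ⁅x, y⁆y is a conjugate of y, and its two factors commute. -/
theorem IsPElt.commutator {q : ℕ} {x y : G} (hy : IsPElt q y) (h : Commute ⁅x, y⁆ y) :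
    IsPElt q ⁅x, y⁆ := by
  obtain ⟨l, hl⟩ := hy
  refine ⟨l, ?_⟩
  have : (⁅x, y⁆ * y) ^ q ^ l = 1 := by
    rw [show ⁅x, y⁆ * y = x * y * x⁻¹ by rw [commutatorElement_def]; group, conj_pow, hl]; group
  rw [h.mul_pow, hl, mul_one] at this
  exact this

end PowerAction

/-! ### Power action on normal sections and nilpotency of the residual -/

section Sections

variable {I : Type v} {σ : I → Set ℕ} {G : Type*} [Group G] {G' : Type*} [Group G']

/-- The `σ i'`-elements of `G` normalise every subgroup of every normal `σ i`-section of `G`. -/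
def NormalisesSections (σ : I → Set ℕ) (G : Type*) [Group G] : Prop :=
  ∀ (i : I) (L N A : Subgroup G), L.Normal → N.Normal → L ≤ A → A ≤ N →
    IsPiNumber (σ i) (L.relIndex N) → ∀ q : ℕ, q.Prime → q ∉ σ i → ∀ g : G, IsPElt q g →
      g ∈ Subgroup.normalizer (A : Set G)

/-- A is `σ`-subnormal because N/L is `σ`-primary, so it permutes with a Hall subgroup K containing
g. Writing ka = a'k' gives kak⁻¹ = a'(k'k⁻¹) with k'k⁻¹ in K ∩ N, which lies in A. -/
theorem normalisesSections_of_permutesHalls [Finite G] (hσ : IsPrimePartition σ)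
    (hG : HasSigmaSeries σ G) (h : ∀ A : Subgroup G, IsSigmaSubnormal σ A → PermutesHalls σ A) :
    NormalisesSections σ G := by
  intro i L N A hL hN hLA hAN hi q hq hqi g hg
  have hstep : SigmaSubnormalStep σ A N := sigmaSubnormalStep_iff.2
    ⟨hAN, Or.inr ⟨i, L, hLA, by rw [Subgroup.normalizer_eq_top]; exact le_top, hi⟩⟩
  have hA := h A (Relation.ReflTransGen.head hstep isSigmaSubnormal_of_normal)
  obtain ⟨j, hj⟩ := hσ.exists_mem hq
  obtain ⟨H, hH⟩ := hG.exists_isHallPi hσ j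
  obtain ⟨K, hK, hgK⟩ := hH.exists_mem hq hj hg
  have hAK := hA j K hK
  have hle := hAK.inf_le hσ (by rintro rfl; exact hqi hj) hAN hK.1
    (hi.of_dvd (Subgroup.relIndex_dvd_of_le_left N hLA))
  refine normalizer_le_of_conj_mem (fun k hk a ha => ?_) hgK
  have h1 : k * a ∈ (K : Set G) * A := ⟨k, hk, a, ha, rfl⟩
  rw [← hAK] at h1
  obtain ⟨a', ha', k', hk', he⟩ := h1
  simp only at he
  have h2 : k * a * k⁻¹ = a' * (k' * k⁻¹) := by rw [← he]; group
  have h3 : k' * k⁻¹ ∈ K ⊓ N := by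
    refine ⟨K.mul_mem hk' (K.inv_mem hk), ?_⟩
    rw [show k' * k⁻¹ = a'⁻¹ * (k * a * k⁻¹) by rw [h2]; group]
    exact N.mul_mem (N.inv_mem (hAN ha')) (hN.conj_mem a (hAN ha) k)
  rw [h2]
  exact A.mul_mem ha' (hle h3)

theorem NormalisesSections.of_surjective [Finite G] (h : NormalisesSections σ G) {f : G →* G'}
    (hf : Function.Surjective f) : NormalisesSections σ G' := by
  intro i L N A hL hN hLA hAN hi q hq hqi g hg
  obtain ⟨g, hg', rfl⟩ := hg.lift hq hf
  have hr : (L.comap f).relIndex (N.comap f) = L.relIndex N := by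
    rw [Subgroup.relIndex_comap, Subgroup.map_comap_eq_self_of_surjective hf]
  have := h i (L.comap f) (N.comap f) (A.comap f) (hL.comap f) (hN.comap f)
    (Subgroup.comap_mono hLA) (Subgroup.comap_mono hAN) (hr ▸ hi) q hq hqi g hg'
  rw [Subgroup.mem_normalizer_iff] at this ⊢
  intro x
  obtain ⟨x, rfl⟩ := hf x
  simpa using this x

theorem NormalisesSections.conj_mem_zpowers (h : NormalisesSections σ G) {i : I}
    {N : Subgroup G} (hN : N.Normal) (hi : IsPiGroup (σ i) N) {q : ℕ} (hq : q.Prime)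
    (hqi : q ∉ σ i) {g : G} (hg : IsPElt q g) : ∀ x ∈ N, g * x * g⁻¹ ∈ Subgroup.zpowers x := by
  intro x hx
  have := h i ⊥ N (Subgroup.zpowers x) inferInstance hN bot_le (Subgroup.zpowers_le.2 hx)
    (by rw [Subgroup.relIndex_bot_left]; exact hi) q hq hqi g hg
  exact (Subgroup.mem_normalizer_iff.1 this x).1 (Subgroup.mem_zpowers x)

theorem eq_one_of_mem_of_isPiGroup [Finite G] {π : Set ℕ} {K L : Subgroup G}
    (hK : IsPiGroup π K) (hL : IsPiGroup πᶜ L) {x : G} (hxK : x ∈ K) (hxL : x ∈ L) : x = 1 := by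
  have : K ⊓ L = ⊥ := by
    rw [← Subgroup.card_eq_one]
    by_contra hne
    obtain ⟨p, hp, hd⟩ := Nat.exists_prime_and_dvd hne
    exact hL p hp (hd.trans (Subgroup.card_dvd_of_le inf_le_right))
      (hK p hp (hd.trans (Subgroup.card_dvd_of_le inf_le_left)))
  have h : x ∈ K ⊓ L := ⟨hxK, hxL⟩
  rwa [this] at h

theorem isPGroup_of_isPiGroup [Finite G] {p : ℕ} {K : Subgroup G} (h : IsPiGroup {p} K) :
    IsPGroup p K := by
  refine IsPGroup.of_card (n := (Nat.card K).primeFactorsList.length)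
    (Nat.eq_prime_pow_of_unique_prime_dvd Nat.card_pos.ne' fun hq hd => h _ hq hd)

theorem IsPGroup.isPElt {p : ℕ} {K : Subgroup G} (h : IsPGroup p K) {x : G} (hx : x ∈ K) :
    IsPElt p x := by
  obtain ⟨k, hk⟩ := h ⟨x, hx⟩
  exact IsPElt.coe (x := ⟨x, hx⟩) ⟨k, hk⟩

/-- A minimal normal subgroup all of whose cyclic subgroups are normal in it is elementary
abelian. -/
theorem exists_elementary_of_minimal [Finite G] {N : Subgroup G} (hN : N.Normal) (hNb : ⊥ < N)
    (hmin : ∀ M : Subgroup G, M.Normal → ⊥ < M → M ≤ N → M = N)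
    (hnorm : ∀ z ∈ N, ∀ w ∈ N, z ∈ Subgroup.normalizer (Subgroup.zpowers w : Set G)) :
    ∃ p : ℕ, p.Prime ∧ (∀ x ∈ N, x ^ p = 1) ∧ ∀ x ∈ N, ∀ y ∈ N, Commute x y := by
  have hcard : Nat.card N ≠ 1 := fun h => hNb.ne' (Subgroup.card_eq_one.1 h)
  obtain ⟨p, hp, hd⟩ := Nat.exists_prime_and_dvd hcard
  have := Fact.mk hp
  obtain ⟨⟨x, hxN⟩, hx1, hxp⟩ := exists_pElt_ne_one hp hd
  have hx1' : x ≠ 1 := by rintro rfl; exact hx1 rfl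
  have hxp' : x ^ p = 1 := by simpa using congrArg Subtype.val hxp
  have hpg : IsPiGroup {p} (piGen {p} N) := by
    -- A commutator of elements of coprime prime power orders lies in both of their cyclic groups,
    -- hence is trivial. So the p-elements of N generate a normal p-subgroup, and minimality makes N
    -- a p-group.
    refine isPiGroup_piGen fun r q hr hq hrp hqp y hy z hz hyr hzq => ?_
    obtain rfl : r = p := hrp
    rw [← commutatorElement_eq_one_iff_commute]
    refine IsPElt.eq_one hr hq (fun h => hqp h.symm) ?_ ?_
    · refine IsPGroup.isPElt hyr.isPGroup_zpowers ?_
      rw [commutatorElement_def, mul_assoc, mul_assoc, ← mul_assoc z]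
      exact Subgroup.mul_mem _ (Subgroup.mem_zpowers y)
        ((Subgroup.mem_normalizer_iff.1 (hnorm z hz y hy) y⁻¹).1
          (Subgroup.inv_mem _ (Subgroup.mem_zpowers y)))
    · refine IsPGroup.isPElt hzq.isPGroup_zpowers ?_
      rw [commutatorElement_def]
      exact Subgroup.mul_mem _ ((Subgroup.mem_normalizer_iff.1 (hnorm y hy z hz) z).1
        (Subgroup.mem_zpowers z)) (Subgroup.inv_mem _ (Subgroup.mem_zpowers z))
  have hT : piGen {p} N = N := by
    refine hmin _ inferInstance (Ne.bot_lt fun h => hx1' ?_) piGen_le_self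
    have : x ∈ piGen {p} N := mem_piGen hp (Set.mem_singleton p) hxN ⟨1, by simpa using hxp'⟩
    rwa [h] at this
  rw [hT] at hpg
  have hNp := isPGroup_of_isPiGroup hpg
  have hnt : Nontrivial N := ⟨⟨x, hxN⟩, 1, hx1⟩
  have hcn := hNp.center_nontrivial
  have hZ : (Subgroup.center N).map N.subtype = N := by
    refine hmin ((Subgroup.center N).map N.subtype)
      (ConjAct.normal_of_characteristic_of_normal (K := Subgroup.center N))
      (Ne.bot_lt fun h => ?_) (Subgroup.map_subtype_le _)
    rw [Subgroup.map_eq_bot_iff_of_injective _ N.subtype_injective] at h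
    obtain ⟨z, hz⟩ := exists_ne (1 : Subgroup.center N)
    exact hz (Subtype.ext ((Subgroup.eq_bot_iff_forall _).1 h z z.2))
  have hcomm : ∀ x ∈ N, ∀ y ∈ N, Commute x y := by
    intro x hx y hy
    rw [← hZ] at hx
    obtain ⟨z, hz, rfl⟩ := hx
    exact (congrArg Subtype.val (Subgroup.mem_center_iff.1 hz ⟨y, hy⟩)).symm
  let Ω : Subgroup G :=
    { carrier := {y | y ∈ N ∧ y ^ p = 1}
      one_mem' := ⟨N.one_mem, one_pow p⟩
      mul_mem' := fun {y z} hy hz =>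
        ⟨N.mul_mem hy.1 hz.1, by rw [(hcomm y hy.1 z hz.1).mul_pow, hy.2, hz.2, one_mul]⟩
      inv_mem' := fun {y} hy => ⟨N.inv_mem hy.1, by rw [inv_pow, hy.2, inv_one]⟩ }
  have hΩn : Ω.Normal := ⟨fun y hy g => ⟨hN.conj_mem y hy.1 g, by
    rw [conj_pow, hy.2]; group⟩⟩
  have hΩ : Ω = N := by
    refine hmin _ hΩn (Ne.bot_lt fun h => hx1' ?_) fun y hy => hy.1
    have : x ∈ Ω := ⟨hxN, hxp'⟩
    rwa [h] at this
  refine ⟨p, hp, fun y hy => ?_, hcomm⟩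
  rw [← hΩ] at hy
  exact hy.2

/-- A `σ i'`-element acts on a minimal normal `σ i`-subgroup centrally. -/
theorem NormalisesSections.commutator_commute [Finite G] (h : NormalisesSections σ G) {i : I}
    {N : Subgroup G} (hN : N.Normal) (hNb : ⊥ < N)
    (hmin : ∀ M : Subgroup G, M.Normal → ⊥ < M → M ≤ N → M = N) (hi : IsPiGroup (σ i) N)
    {q : ℕ} (hq : q.Prime) (hqi : q ∉ σ i) {g : G} (hg : IsPElt q g) (k : G) {x : G}
    (hx : x ∈ N) : Commute ⁅k, g⁆ x := by
  have hpow := h.conj_mem_zpowers hN hi hq hqi hg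
  -- It is enough that g and its conjugate by k induce the same automorphism of N.
  suffices key : ∀ u ∈ N, (k * g * k⁻¹) * u * (k * g * k⁻¹)⁻¹ = g * u * g⁻¹ by
    have h1 := key (g⁻¹ * x * g) (by simpa using hN.conj_mem x hx g⁻¹)
    have h2 : ⁅k, g⁆ * x * ⁅k, g⁆⁻¹ = x := by
      calc ⁅k, g⁆ * x * ⁅k, g⁆⁻¹ = (k * g * k⁻¹) * (g⁻¹ * x * g) * (k * g * k⁻¹)⁻¹ := by
            rw [commutatorElement_def]; group
        _ = x := by rw [h1]; group
    exact mul_inv_eq_iff_eq_mul.1 h2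
  by_cases hc : ∀ u ∈ N, Commute g u
  · intro u hu
    have h1 : g * u * g⁻¹ = u := by rw [(hc u hu).eq, mul_inv_cancel_right]
    have h2 := (hc (k⁻¹ * u * k) (by simpa using hN.conj_mem u hu k⁻¹)).eq
    rw [h1]
    calc (k * g * k⁻¹) * u * (k * g * k⁻¹)⁻¹ = k * (g * (k⁻¹ * u * k)) * g⁻¹ * k⁻¹ := by group
      _ = u := by rw [h2]; group
  push Not at hc
  obtain ⟨y, hy, hgy⟩ := hc
  -- S is the norm of N, the elements of N normalising every cyclic subgroup of N. It contains
  -- y⁻¹(gyg⁻¹) ≠ 1, so by minimality it is N; then N is elementary abelian and g acts as a uniform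
  -- power.
  let S : Subgroup G :=
    { carrier := {d | d ∈ N ∧ ∀ w ∈ N, d ∈ Subgroup.normalizer (Subgroup.zpowers w : Set G)}
      one_mem' := ⟨N.one_mem, fun w _ => Subgroup.one_mem _⟩
      mul_mem' := fun {a b} ha hb =>
        ⟨N.mul_mem ha.1 hb.1, fun w hw => Subgroup.mul_mem _ (ha.2 w hw) (hb.2 w hw)⟩
      inv_mem' := fun {a} ha => ⟨N.inv_mem ha.1, fun w hw => Subgroup.inv_mem _ (ha.2 w hw)⟩ }
  have hSn : S.Normal := by
    refine ⟨fun d hd c => ⟨hN.conj_mem d hd.1 c, fun w hw => ?_⟩⟩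
    have hw' := hN.conj_mem w hw c⁻¹
    have hd' := Subgroup.mem_normalizer_iff.1 (hd.2 _ hw')
    have hconj : ∀ v, v ∈ Subgroup.zpowers w ↔
        c⁻¹ * v * c ∈ Subgroup.zpowers (c⁻¹ * w * c⁻¹⁻¹) := by
      intro v
      constructor
      · rintro ⟨n, rfl⟩
        exact ⟨n, by simp only; rw [conj_zpow]; group⟩
      · rintro ⟨n, hn⟩
        refine ⟨n, ?_⟩
        simp only at hn ⊢
        rw [conj_zpow] at hn
        have : w ^ n = c * (c⁻¹ * w ^ n * c⁻¹⁻¹) * c⁻¹ := by group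
        rw [this, hn]; group
    rw [Subgroup.mem_normalizer_iff]
    intro v
    have e := hd' (c⁻¹ * v * c)
    have e2 := hconj (c * d * c⁻¹ * v * (c * d * c⁻¹)⁻¹)
    rw [show c⁻¹ * (c * d * c⁻¹ * v * (c * d * c⁻¹)⁻¹) * c = d * (c⁻¹ * v * c) * d⁻¹ by group] at e2
    exact (hconj v).trans (e.trans e2.symm)
  have hS : S = N := by
    refine hmin S hSn (Ne.bot_lt fun hb => hgy ?_) fun d hd => hd.1
    have : y⁻¹ * (g * y * g⁻¹) ∈ S := ⟨N.mul_mem (N.inv_mem hy) (hN.conj_mem y hy g),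
      fun w hw => inv_mul_conj_mem_normalizer hpow hw hy⟩
    rw [hb, Subgroup.mem_bot, inv_mul_eq_one] at this
    exact mul_inv_eq_iff_eq_mul.1 this.symm
  obtain ⟨p, hp, hexp, hcomm⟩ := exists_elementary_of_minimal hN hNb hmin
    fun z hz w hw => (hS ▸ hz : z ∈ S).2 w hw
  intro u hu
  have hu' : k⁻¹ * u * k ∈ N := by simpa using hN.conj_mem u hu k⁻¹
  obtain ⟨m, h1, h2⟩ := exists_common_zpow hp (hcomm u hu _ hu') (hexp u hu)
    (hpow u hu) (hpow _ hu') (hpow _ (N.mul_mem hu hu'))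
  calc (k * g * k⁻¹) * u * (k * g * k⁻¹)⁻¹ = k * (g * (k⁻¹ * u * k) * g⁻¹) * k⁻¹ := by group
    _ = g * u * g⁻¹ := by
      rw [h2, h1]
      have : k⁻¹ * u * k = k⁻¹ * u * k⁻¹⁻¹ := by group
      rw [this, conj_zpow]; group

theorem NormalisesSections.residual_commute_minimal [Finite G] (h : NormalisesSections σ G) {i : I}
    {N : Subgroup G} (hN : N.Normal) (hNb : ⊥ < N)
    (hmin : ∀ M : Subgroup G, M.Normal → ⊥ < M → M ≤ N → M = N) (hi : IsPiGroup (σ i) N)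
    {d x : G} (hd : d ∈ sigmaCommutator σ G) (hx : x ∈ N) : Commute d x := by
  have : sigmaCommutator σ G ≤ Subgroup.centralizer {x} := by
    refine sigmaCommutator_le fun p q hpq y z hy hz => ?_
    rw [Subgroup.mem_centralizer_singleton_iff]
    by_cases hqi : q ∈ σ i
    · have := h.commutator_commute hN hNb hmin hi hpq.1 (hpq.symm.2.2 i hqi) hy z hx
      rw [← commutatorElement_inv]
      exact this.inv_left
    · exact h.commutator_commute hN hNb hmin hi hpq.2.1 hqi hz y hx
  exact Subgroup.mem_centralizer_singleton_iff.1 (this hd)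

/-- The residual is nilpotent: its elements of coprime prime power orders commute. -/
theorem NormalisesSections.residual_nilpotent {G : Type u} [Group G] [Finite G]
    (hG : IsSigmaSoluble σ G) (h : NormalisesSections σ G) {p q : ℕ} (hp : p.Prime) (hq : q.Prime)
    (hpq : p ≠ q) {x y : G} (hx : x ∈ sigmaCommutator σ G) (hy : y ∈ sigmaCommutator σ G)
    (hxp : IsPElt p x) (hyq : IsPElt q y) : Commute x y := by
  induction hn : Nat.card G using Nat.strong_induction_on generalizing G with
  | _ n ih =>
  subst hn
  by_cases hD : sigmaCommutator σ G = ⊥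
  · rw [hD, Subgroup.mem_bot] at hx
    rw [hx]; exact Commute.one_left y
  obtain ⟨N, hN, hNb, hND, hmin, i, hi⟩ := hG.exists_isPiNumber (σ := σ) (L := ⊥) inferInstance
    (sigmaCommutator_normal (σ := σ)) (Ne.bot_lt hD)
  rw [Subgroup.relIndex_bot_left] at hi
  have hf := QuotientGroup.mk'_surjective N
  have hmap : ∀ d ∈ sigmaCommutator σ G, QuotientGroup.mk' N d ∈ sigmaCommutator σ (G ⧸ N) := by
    intro d hd
    rw [← map_sigmaCommutator hf]
    exact Subgroup.mem_map_of_mem _ hd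
  have hlt : Nat.card (G ⧸ N) < Nat.card G := by
    have h1 := N.card_mul_index
    have h2 : 1 < Nat.card N := N.one_lt_card_iff_ne_bot.2 hNb.ne'
    have h3 : 0 < N.index := Nat.card_pos
    rw [← Subgroup.index_eq_card, ← h1]
    nlinarith
  have hc := ih _ hlt (hG.of_surjective hf) (h.of_surjective hf) (hmap x hx) (hmap y hy)
    (hxp.map _) (hyq.map _) rfl
  have hcN : ⁅x, y⁆ ∈ N := by
    rw [← commutatorElement_eq_one_iff_commute, ← map_commutatorElement, QuotientGroup.mk'_apply,
      QuotientGroup.eq_one_iff] at hc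
    exact hc
  have hcx : Commute ⁅x, y⁆ x := (h.residual_commute_minimal hN hNb hmin hi hx hcN).symm
  have hcy : Commute ⁅x, y⁆ y := (h.residual_commute_minimal hN hNb hmin hi hy hcN).symm
  rw [← commutatorElement_eq_one_iff_commute]
  -- The commutator lies in N, which D centralises, so it commutes with x and y and is both a
  -- p-element and a q-element.
  refine IsPElt.eq_one hp hq hpq ?_ (hyq.commutator hcy)
  rw [← commutatorElement_inv]
  refine (hxp.commutator ?_).inv
  rw [← commutatorElement_inv]; exact hcx.inv_left

/-- The structure of the group when the residual is a nontrivial `p`-group. -/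
theorem NormalisesSections.of_isPGroup_residual [Finite G] (hσ : IsPrimePartition σ)
    (h : NormalisesSections σ G) {i : I} {p : ℕ} (hp : p.Prime) (hpi : p ∈ σ i)
    (hDp : IsPGroup p (sigmaCommutator σ G)) (hD : sigmaCommutator σ G ≠ ⊥) :
    p ≠ 2 ∧ ¬ p ∣ (sigmaCommutator σ G).index ∧
      ∀ r : ℕ, r ∈ σ i → ∀ x ∈ sigmaCommutator σ G, ∀ z : G, IsPElt r z → Commute x z := by
  have := Fact.mk hp
  set D := sigmaCommutator σ G with hDdef
  obtain ⟨q, hq, hqi, g, hg, hgD⟩ : ∃ q : ℕ, q.Prime ∧ q ∉ σ i ∧ ∃ g : G, IsPElt q g ∧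
      ∃ x ∈ D, ¬ Commute g x := by
    by_contra hcon
    -- If every `σ i'`-element centralised the p-group D, its commutators lying in D would be both
    -- p-elements and p'-elements. Of two separated primes at least one is outside `σ i`, so D would
    -- be trivial.
    push Not at hcon
    have key : ∀ r s : ℕ, SepPrimes σ r s → s ∉ σ i → ∀ x y : G, IsPElt r x → IsPElt s y →
        ⁅x, y⁆ = 1 := by
      intro r s hrs hsi x y hx hy
      have hc : ⁅x, y⁆ ∈ D := commutator_mem_sigmaCommutator hrs hx hy
      have hcs := hy.commutator (hcon s hrs.2.1 hsi y hy _ hc).symm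
      exact (IsPGroup.isPElt hDp hc).eq_one hp hrs.2.1 (by rintro rfl; exact hsi hpi) hcs
    refine hD (eq_bot_iff.2 (sigmaCommutator_le fun r s hrs x y hx hy => ?_))
    rw [Subgroup.mem_bot]
    by_cases hsi : s ∈ σ i
    · rw [← commutatorElement_inv, key s r hrs.symm (hrs.symm.2.2 i hsi) y x hy hx, inv_one]
    · exact key r s hrs hsi x y hx hy
  obtain ⟨d₀, hd₀, hgd₀⟩ := hgD
  have hpq : p ≠ q := by rintro rfl; exact hqi hpi
  have hHn : (piGen (σ i) (⊤ : Subgroup G) ⊔ D).Normal := inferInstance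
  have hH : IsPiGroup (σ i) (piGen (σ i) (⊤ : Subgroup G) ⊔ D : Subgroup G) := by
    have h1 := isPiNumber_relIndex_piGen_sup (G := G) hσ i
    have h2 : IsPiNumber (σ i) (Nat.card D) := by
      intro r hr hd
      obtain ⟨n, hn⟩ := hDp.exists_card_eq
      rw [hn] at hd
      rwa [(Nat.prime_dvd_prime_iff_eq hr hp).1 (hr.dvd_of_dvd_pow hd)]
    have := h2.mul h1
    rw [← Subgroup.relIndex_bot_left, Subgroup.relIndex_mul_relIndex _ _ _ bot_le le_sup_right,
      Subgroup.relIndex_bot_left] at this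
    exact this
  have hpow := h.conj_mem_zpowers hHn hH hq hqi hg
  have hmemH : ∀ r : ℕ, r ∈ σ i → ∀ z : G, IsPElt r z →
      z ∈ piGen (σ i) (⊤ : Subgroup G) ⊔ D := fun r hr z hz =>
    Subgroup.mem_sup_left (mem_piGen (hσ.prime hr) hr (Subgroup.mem_top z) hz)
  obtain ⟨P, hDP⟩ := hDp.exists_le_sylow
  have hPH : ∀ x ∈ P, x ∈ piGen (σ i) (⊤ : Subgroup G) ⊔ D := fun x hx =>
    hmemH p hpi x (IsPGroup.isPElt P.isPGroup' hx)
  have hpowP : ∀ x ∈ (P : Subgroup G), g * x * g⁻¹ ∈ Subgroup.zpowers x :=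
    fun x hx => hpow x (hPH x hx)
  have hfix : ∀ x ∈ (P : Subgroup G), Commute g x → x = 1 := by
    intro x hx hgx
    by_contra hx1
    exact hgd₀ (commute_of_power_of_commute hp hq hpq hg P.isPGroup' hpowP hx hx1 hgx (hDP hd₀))
  -- Without fixed points every element of P is a commutator with g, and p and q are separated.
  have hPD : (P : Subgroup G) ≤ D := by
    intro x hx
    obtain ⟨y, hy, rfl⟩ := inv_mul_conj_surj
      (fun x hx => (Subgroup.zpowers_le.2 hx) (hpowP x hx)) hfix hx
    have : y⁻¹ * (g * y * g⁻¹) = ⁅y⁻¹, g⁆ := by rw [commutatorElement_def]; group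
    rw [this]
    exact commutator_mem_sigmaCommutator (hσ.sep hpi hq hqi)
      (IsPGroup.isPElt P.isPGroup' hy).inv hg
  have hPD' : (P : Subgroup G) = D := le_antisymm hPD hDP
  have hidx : ¬ p ∣ D.index := hPD' ▸ P.not_dvd_index
  rw [hPD'] at hpowP hfix
  refine ⟨?_, hidx, ?_⟩
  -- For p = 2, an involution of D is sent by g to one of its powers, hence to itself, contradicting
  -- the absence of fixed points.
  · rintro rfl
    obtain ⟨⟨x, hxD⟩, hx1, hx2⟩ := exists_pElt_ne_one (G := D) hp (by
      obtain ⟨n, hn⟩ := hDp.exists_card_eq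
      rw [hn]
      refine dvd_pow_self 2 ?_
      rintro rfl
      exact hD (Subgroup.card_eq_one.1 (by simpa using hn)))
    have hx1' : x ≠ 1 := by rintro rfl; exact hx1 rfl
    have hx2' : x ^ 2 = 1 := by simpa using congrArg Subtype.val hx2
    obtain ⟨n, hn⟩ := hpowP x hxD
    simp only at hn
    refine hx1' (hfix x hxD (mul_inv_eq_iff_eq_mul.1 (hn.symm.trans
      (zpow_eq_self_of_dvd hx2' ?_))))
    by_contra hodd
    have : (2 : ℤ) ∣ n := by omega
    obtain ⟨c, rfl⟩ := this
    rw [zpow_mul, show x ^ (2 : ℤ) = 1 by exact_mod_cast hx2', one_zpow] at hn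
    have : x = 1 := by
      have := hn.symm
      rw [mul_inv_eq_one, mul_eq_left] at this
      exact this
    exact hx1' this
  · intro r hr x hx z hz
    have hrp := hσ.prime hr
    by_cases hrp' : r = p
    · subst hrp'
      have hzD : z ∈ D := by
        refine pElt_mem_of_isPiNumber_relIndex (π := {r}ᶜ) (B := ⊤)
          (by rw [Subgroup.normalizer_eq_top]) ?_ hp (by simp) (Subgroup.mem_top z) hz
        rw [Subgroup.relIndex_top_right]
        rintro s - hd rfl
        exact hidx hd
      exact commute_of_power_of_fixedPointFree hpowP hfix hx hzD
    -- For r ≠ p, the element y⁻¹(gyg⁻¹) normalises the cyclic group of z, so the commutator lies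
    -- both in the p-group D and in that r-group.
    · obtain ⟨y, hy, rfl⟩ := inv_mul_conj_surj
        (fun x hx => (Subgroup.zpowers_le.2 hx) (hpowP x hx)) hfix hx
      have hn := inv_mul_conj_mem_normalizer hpow (hmemH r hr z hz) (hPH y (hDP hy))
      set x := y⁻¹ * (g * y * g⁻¹)
      rw [← commutatorElement_eq_one_iff_commute]
      have hcD : ⁅x, z⁆ ∈ D := by
        rw [commutatorElement_def, mul_assoc, mul_assoc, ← mul_assoc z]
        exact D.mul_mem hx (sigmaCommutator_normal.conj_mem _ (D.inv_mem hx) z)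
      refine IsPElt.eq_one hp hrp (Ne.symm hrp') (IsPGroup.isPElt hDp hcD)
        (IsPGroup.isPElt hz.isPGroup_zpowers ?_)
      rw [commutatorElement_def]
      exact Subgroup.mul_mem _ ((Subgroup.mem_normalizer_iff.1 hn z).1
        (Subgroup.mem_zpowers z)) (Subgroup.inv_mem _ (Subgroup.mem_zpowers z))

end Sections

/-! ### From `σ`-subnormal subgroups in `τ` to the structure of G -/

section ResidualStructure

variable {I : Type v} {σ : I → Set ℕ} {G : Type*} [Group G] {G' : Type*} [Group G']

/-- The `σ`-nilpotent residual `D` is an abelian Hall subgroup all of whose subgroups are normal in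
`G`, and the `σ i`-elements of `G` centralise the `σ i`-elements of `D`. -/
structure ResidualConditions (σ : I → Set ℕ) (G : Type*) [Group G] : Prop where
  comm : ∀ x ∈ sigmaCommutator σ G, ∀ y ∈ sigmaCommutator σ G, Commute x y
  hall : ∀ p : ℕ, p.Prime → p ∣ Nat.card (sigmaCommutator σ G) →
    ¬ p ∣ (sigmaCommutator σ G).index
  normal_of_le : ∀ K ≤ sigmaCommutator σ G, K.Normal
  commute : ∀ (i : I) (p r : ℕ), p ∈ σ i → r ∈ σ i → ∀ x ∈ sigmaCommutator σ G, IsPElt p x →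
    ∀ z : G, IsPElt r z → Commute x z

/-- Factoring out the p'-part E of the nilpotent group D reduces to a p-group residual. Index and
parity transfer directly; a commutator trivial modulo E also lies in the p-part of D, hence is
trivial. -/
theorem NormalisesSections.residual_local {G : Type u} [Group G] [Finite G]
    (hσ : IsPrimePartition σ) (hG : IsSigmaSoluble σ G) (h : NormalisesSections σ G) {i : I} {p : ℕ}
    (hp : p.Prime) (hpi : p ∈ σ i) (hd : p ∣ Nat.card (sigmaCommutator σ G)) :
    p ≠ 2 ∧ ¬ p ∣ (sigmaCommutator σ G).index ∧
      ∀ r : ℕ, r ∈ σ i → ∀ x ∈ sigmaCommutator σ G, IsPElt p x → ∀ z : G, IsPElt r z →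
        Commute x z := by
  set D := sigmaCommutator σ G with hDdef
  have hE : IsPiGroup {p}ᶜ (piGen {p}ᶜ D) := by
    refine isPiGroup_piGen fun r q hr hq hrp hqp x hx y hy hxr hyq => ?_
    exact h.residual_nilpotent hG hr hq (fun e => hqp (e ▸ hrp)) hx hy hxr hyq
  have hT : IsPiGroup {p} (piGen {p} D) := by
    refine isPiGroup_piGen fun r q hr hq hrp hqp x hx y hy hxr hyq => ?_
    exact h.residual_nilpotent hG hr hq (fun e => hqp (e ▸ hrp)) hx hy hxr hyq
  set E := piGen {p}ᶜ D with hEdef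
  have hf := QuotientGroup.mk'_surjective E
  have hmap : D.map (QuotientGroup.mk' E) = sigmaCommutator σ (G ⧸ E) := map_sigmaCommutator hf
  have hDp : IsPGroup p (sigmaCommutator σ (G ⧸ E)) := by
    refine isPGroup_of_isPiGroup (isPiGroup_coe_iff.2 ?_)
    rw [← hmap]
    intro q hq hqp y hy hyq
    obtain ⟨x, hxq, hx⟩ := (IsPElt.of_coe (x := ⟨y, hy⟩) hyq).lift hq
      ((QuotientGroup.mk' E).subgroupMap_surjective D)
    have hx' : QuotientGroup.mk' E x = y := congrArg Subtype.val hx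
    rw [← hx', QuotientGroup.mk'_apply, QuotientGroup.eq_one_iff]
    exact mem_piGen hq hqp x.2 hxq.coe
  have hne : sigmaCommutator σ (G ⧸ E) ≠ ⊥ := by
    rw [← hmap, Ne, Subgroup.map_eq_bot_iff, QuotientGroup.ker_mk']
    intro hle
    exact hE p hp (hd.trans (Subgroup.card_dvd_of_le hle)) rfl
  obtain ⟨h1, h2, h3⟩ := (h.of_surjective hf).of_isPGroup_residual hσ hp hpi hDp hne
  refine ⟨h1, ?_, ?_⟩
  · rwa [← hmap, Subgroup.index_map_eq D hf (by rw [QuotientGroup.ker_mk']; exact piGen_le_self)]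
      at h2
  · intro r hr x hx hxp z hz
    have hc := h3 r hr (QuotientGroup.mk' E x) (hmap ▸ Subgroup.mem_map_of_mem _ hx)
      (QuotientGroup.mk' E z) (hz.map _)
    rw [← commutatorElement_eq_one_iff_commute, ← map_commutatorElement, QuotientGroup.mk'_apply,
      QuotientGroup.eq_one_iff] at hc
    rw [← commutatorElement_eq_one_iff_commute]
    refine eq_one_of_mem_of_isPiGroup hT hE ?_ hc
    have hx' : x ∈ piGen {p} D := mem_piGen hp (Set.mem_singleton p) hx hxp
    have hn : (piGen {p} D).Normal := inferInstance
    rw [commutatorElement_def, mul_assoc, mul_assoc, ← mul_assoc z]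
    exact Subgroup.mul_mem _ hx' (hn.conj_mem _ (Subgroup.inv_mem _ hx') z)

theorem NormalisesSections.residualConditions {G : Type u} [Group G] [Finite G]
    (hσ : IsPrimePartition σ) (hG : IsSigmaSoluble σ G) (h : NormalisesSections σ G) :
    ResidualConditions σ G := by
  set D := sigmaCommutator σ G with hDdef
  have hcomm : ∀ (i : I) (p r : ℕ), p ∈ σ i → r ∈ σ i → ∀ x ∈ D, IsPElt p x →
      ∀ z : G, IsPElt r z → Commute x z := by
    intro i p r hp hr x hx hxp z hz
    by_cases hd : p ∣ Nat.card D
    · exact (h.residual_local hσ hG (hσ.prime hp) hp hd).2.2 r hr x hx hxp z hz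
    · have : (⟨x, hx⟩ : D) = 1 :=
        (IsPElt.of_coe (x := ⟨x, hx⟩) hxp).eq_one_of_not_dvd (hσ.prime hp) pow_card_eq_one' hd
      have : x = 1 := congrArg Subtype.val this
      rw [this]; exact Commute.one_left z
  refine ⟨?_, ?_, ?_, hcomm⟩
  · intro x hx y hy
    have h1 : ∀ p : ℕ, p.Prime → ∀ y ∈ D, IsPElt p y → D ≤ Subgroup.centralizer {y} := by
      intro p hp y hy hyp
      refine le_of_pElt_mem fun q hq z hz hzq => ?_
      rw [Subgroup.mem_centralizer_singleton_iff]
      by_cases hpq : p = q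
      · subst hpq
        obtain ⟨i, hi⟩ := hσ.exists_mem hp
        exact hcomm i p p hi hi z hz hzq y hyp
      · exact h.residual_nilpotent hG hq hp (Ne.symm hpq) hz hy hzq hyp
    have h2 : D ≤ Subgroup.centralizer {x} := by
      refine le_of_pElt_mem fun p hp z hz hzp => ?_
      have := h1 p hp z hz hzp hx
      rw [Subgroup.mem_centralizer_singleton_iff] at this ⊢
      exact this.symm
    exact (Subgroup.mem_centralizer_singleton_iff.1 (h2 hy)).symm
  · intro p hp hd
    obtain ⟨i, hi⟩ := hσ.exists_mem hp
    exact (h.residual_local hσ hG hp hi hd).2.1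
  · intro K hK
    have hconj : ∀ q : ℕ, q.Prime → ∀ g : G, IsPElt q g → ∀ x ∈ K, g * x * g⁻¹ ∈ K := by
      intro q hq g hg
      have : K ≤ K.comap (MulAut.conj g).toMonoidHom := by
        refine le_of_pElt_mem fun p hp x hx hxp => ?_
        obtain ⟨i, hi⟩ := hσ.exists_mem hp
        suffices hz : g * x * g⁻¹ ∈ Subgroup.zpowers x from Subgroup.zpowers_le.2 hx hz
        -- Elements of the class of p centralise x; the others act by powers on the normal `σ
        -- i`-part of D.
        by_cases hqi : q ∈ σ i
        · have := (hcomm i p q hi hqi x (hK hx) hxp g hg).eq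
          rw [← this, mul_inv_cancel_right]
          exact Subgroup.mem_zpowers x
        · refine h.conj_mem_zpowers (N := piGen (σ i) D) inferInstance ?_ hq hqi hg x
            (mem_piGen hp hi (hK hx) hxp)
          exact isPiGroup_piGen fun r s hr hs hri hsi a ha b hb har hbs =>
            h.residual_nilpotent hG hr hs (fun e => hsi (e ▸ hri)) ha hb har hbs
      exact this
    rw [← Subgroup.normalizer_eq_top_iff, eq_top_iff]
    refine le_of_pElt_mem fun q hq g _ hg => ?_
    refine normalizer_le_of_conj_mem (B := Subgroup.zpowers g) ?_ (Subgroup.mem_zpowers g)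
    exact fun b hb => hconj q hq b (IsPGroup.isPElt hg.isPGroup_zpowers hb)

theorem NormalisesSections.odd_card_residual {G : Type u} [Group G] [Finite G]
    (hσ : IsPrimePartition σ) (hG : IsSigmaSoluble σ G) (h : NormalisesSections σ G) :
    Odd (Nat.card (sigmaCommutator σ G)) := by
  rw [← Nat.not_even_iff_odd, even_iff_two_dvd]
  intro hd
  obtain ⟨i, hi⟩ := hσ.exists_mem Nat.prime_two
  exact (h.residual_local hσ hG Nat.prime_two hi hd).1 rfl

theorem eq_one_of_isPiNumber {π : Set ℕ} {n : ℕ} (h : IsPiNumber π n)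
    (h' : ∀ p : ℕ, p.Prime → p ∣ n → p ∉ π) : n = 1 := by
  by_contra hne
  obtain ⟨p, hp, hd⟩ := Nat.exists_prime_and_dvd hne
  exact h' p hp hd (h p hp hd)

/-- A normal `π`-subgroup lies in every Hall `π`-subgroup. -/
theorem IsHallPi.le_of_normal {π : Set ℕ} {O H : Subgroup G} (h : IsHallPi π H) [O.Normal]
    (hO : IsPiGroup π O) : O ≤ H := by
  have h1 : H.relIndex O = H.relIndex (O ⊔ H) := by
    refine relIndex_eq_of_mul le_sup_left fun x hx => ?_
    rw [← SetLike.mem_coe, Subgroup.normal_mul] at hx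
    obtain ⟨o, ho, y, hy, rfl⟩ := hx
    exact ⟨o, ho, y, hy, rfl⟩
  rw [← Subgroup.relIndex_eq_one]
  refine eq_one_of_isPiNumber (IsPiNumber.of_dvd hO (Subgroup.relIndex_dvd_card _ _))
    fun p hp hd => h.2 p hp ?_
  rw [h1] at hd
  exact hd.trans (Subgroup.relIndex_dvd_index_of_le le_sup_right)

/-- The index of HD in the right-hand side is a `σ i`-number and divides |G : H|, so it is 1. In
particular HD is normal and does not depend on H. -/
theorem IsHallPi.sup_residual [Finite G] (hσ : IsPrimePartition σ) {i : I} {H : Subgroup G}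
    (h : IsHallPi (σ i) H) :
    H ⊔ sigmaCommutator σ G = piGen (σ i) (⊤ : Subgroup G) ⊔ sigmaCommutator σ G := by
  have hle : H ⊔ sigmaCommutator σ G ≤ piGen (σ i) (⊤ : Subgroup G) ⊔ sigmaCommutator σ G := by
    refine sup_le_sup_right (le_of_pElt_mem fun p hp x hx hxp => ?_) _
    by_cases hpi : p ∈ σ i
    · exact mem_piGen hp hpi (Subgroup.mem_top x) hxp
    · rw [(isPiGroup_coe_iff.1 h.1) p hp hpi x hx hxp]
      exact Subgroup.one_mem _
  refine le_antisymm hle ?_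
  rw [← Subgroup.relIndex_eq_one]
  refine eq_one_of_isPiNumber ((isPiNumber_relIndex_piGen_sup (G := G) hσ i).of_dvd
    (Subgroup.relIndex_dvd_of_le_left _ le_sup_right)) fun p hp hd => h.2 p hp ?_
  exact hd.trans ((Subgroup.relIndex_dvd_index_of_le hle).trans
    (Subgroup.index_dvd_of_le le_sup_left))

/-- HD is normal, so v⁻¹hv = dh' and hv = (vd)h' with vd in V. -/
theorem permutesHalls_of_residual_le [Finite G] (hσ : IsPrimePartition σ) {V : Subgroup G}
    (hV : sigmaCommutator σ G ≤ V) : PermutesHalls σ V := by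
  intro i H hH
  refine permutes_of_forall fun h hh v hv => ?_
  have hn : (H ⊔ sigmaCommutator σ G).Normal := by
    rw [hH.sup_residual hσ]; infer_instance
  have h1 := hn.conj_mem h (Subgroup.mem_sup_left hh) v⁻¹
  rw [sup_comm, ← SetLike.mem_coe, Subgroup.normal_mul] at h1
  obtain ⟨d, hd, h', hh', he⟩ := h1
  refine ⟨v * d, V.mul_mem hv (hV hd), h', hh', ?_⟩
  simp only at he ⊢
  rw [mul_assoc, he]; group

/-- The projection onto a complement of a normal subgroup. -/
theorem exists_retraction {D M : Subgroup G} [D.Normal] (h : Subgroup.IsComplement' D M) :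
    ∃ φ : G →* M, Function.Surjective φ ∧ φ.ker = D ∧ ∀ m : M, φ m = m := by
  let ψ : M →* G ⧸ D := (QuotientGroup.mk' D).comp M.subtype
  have hψ : Function.Bijective ψ := by
    constructor
    · rw [injective_iff_map_eq_one]
      intro m hm
      have : (m : G) ∈ D := (QuotientGroup.eq_one_iff _).1 hm
      have := h.disjoint.le_bot ⟨this, m.2⟩
      exact Subtype.ext (Subgroup.mem_bot.1 this)
    · intro y
      obtain ⟨g, rfl⟩ := QuotientGroup.mk'_surjective D y
      have hg : g ∈ ((D ⊔ M : Subgroup G) : Set G) := by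
        rw [h.sup_eq_top]; trivial
      rw [Subgroup.normal_mul] at hg
      obtain ⟨d, hd, m, hm, rfl⟩ := hg
      refine ⟨⟨m, hm⟩, ?_⟩
      simp only [ψ, MonoidHom.comp_apply, Subgroup.coe_subtype, map_mul]
      rw [show QuotientGroup.mk' D d = 1 from (QuotientGroup.eq_one_iff d).2 hd, one_mul]
  let e := MulEquiv.ofBijective ψ hψ
  refine ⟨e.symm.toMonoidHom.comp (QuotientGroup.mk' D),
    e.symm.surjective.comp (QuotientGroup.mk'_surjective D), ?_, ?_⟩
  · ext x
    simp
  · intro m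
    exact e.symm_apply_apply m

theorem map_piCore_eq [Finite G] {π : Set ℕ} {D : Subgroup G}
    (hD : ∀ x ∈ D, ∀ y ∈ D, Commute x y) : (piCore π D).map D.subtype = piGen π D := by
  apply le_antisymm
  · rw [Subgroup.map_le_iff_le_comap]
    refine sSup_le ?_
    rintro N ⟨-, hN⟩
    refine le_of_pElt_mem fun p hp x hx hxp => ?_
    by_cases hpπ : p ∈ π
    · exact mem_piGen hp hpπ x.2 hxp.coe
    · rw [isPiGroup_coe_iff.1 hN p hp hpπ x hx hxp]
      exact Subgroup.one_mem _
  · refine piGen_le fun p hp hpπ x hx hxp => ⟨⟨x, hx⟩, ?_, rfl⟩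
    have hmem : Subgroup.zpowers (⟨x, hx⟩ : D) ∈
        {N : Subgroup D | N.Normal ∧ IsPiGroup π N} := by
      constructor
      · refine ⟨fun n hn g => ?_⟩
        have : g * n = n * g := Subtype.ext (hD g g.2 n n.2)
        rwa [this, mul_inv_cancel_right]
      · rw [isPiGroup_coe_iff]
        intro q hq hqπ y hy hyq
        exact (IsPGroup.isPElt (IsPElt.of_coe (x := (⟨x, hx⟩ : D)) hxp).isPGroup_zpowers hy).eq_one
          hp hq (fun e => hqπ (e ▸ hpπ)) hyq
    exact le_sSup hmem (Subgroup.mem_zpowers _)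

theorem ResidualConditions.isPiGroup_piGen [Finite G] (h : ResidualConditions σ G) (π : Set ℕ) :
    IsPiGroup π (piGen π (sigmaCommutator σ G)) :=
  SigmaTheory.isPiGroup_piGen fun _ _ _ _ _ _ x hx y hy _ _ => h.comm x hx y hy

/-- In every Hall `σ i`-subgroup, the `σ i`-part of the residual has a normal complement. -/
theorem ResidualConditions.hasNormalComplementIn [Finite G] (h : ResidualConditions σ G) {i : I}
    {H : Subgroup G} (hH : IsHallPi (σ i) H) :
    HasNormalComplementIn ((piCore (σ i) (sigmaCommutator σ G)).map
      (sigmaCommutator σ G).subtype) H := by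
  rw [map_piCore_eq h.comm]
  set D := sigmaCommutator σ G with hDdef
  set O := piGen (σ i) D with hOdef
  have hOπ : IsPiGroup (σ i) O := h.isPiGroup_piGen (σ i)
  have hOH : O ≤ H := hH.le_of_normal hOπ
  refine ⟨hOH, ?_⟩
  -- O is central in H, so the complement given by Schur-Zassenhaus is automatically normal.
  have hcen : ∀ o ∈ O, ∀ x ∈ H, Commute x o := by
    intro o ho x hx
    have : H ≤ Subgroup.centralizer {o} := by
      refine le_of_pElt_mem fun r hr z hz hzr => ?_
      by_cases hri : r ∈ σ i
      · have : O ≤ Subgroup.centralizer {z} := by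
          refine piGen_le fun p hp hpi y hy hyp => ?_
          rw [Subgroup.mem_centralizer_singleton_iff]
          exact h.commute i p r hpi hri y hy hyp z hzr
        rw [Subgroup.mem_centralizer_singleton_iff]
        exact (Subgroup.mem_centralizer_singleton_iff.1 (this ho)).symm
      · rw [isPiGroup_coe_iff.1 hH.1 r hr hri z hz hzr]
        exact Subgroup.one_mem _
    exact Subgroup.mem_centralizer_singleton_iff.1 (this hx)
  have hcop : Nat.Coprime (Nat.card (O.subgroupOf H)) (O.subgroupOf H).index := by
    rw [Nat.card_congr (Subgroup.subgroupOfEquivOfLe hOH).toEquiv]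
    refine Nat.coprime_of_dvd fun p hp h1 h2 => ?_
    have h3 : p ∣ O.index := h2.trans (Subgroup.relIndex_dvd_index_of_le hOH)
    rw [← Subgroup.relIndex_mul_index (piGen_le_self : O ≤ D), hp.dvd_mul] at h3
    rcases h3 with h3 | h3
    · have : IsPiNumber (σ i)ᶜ (O.relIndex D) :=
        isPiNumber_relIndex fun q hq hqi x hx hxq => mem_piGen hq (by simpa using hqi) hx hxq
      exact this p hp h3 (hOπ p hp h1)
    · exact h.hall p hp (h1.trans (Subgroup.card_dvd_of_le piGen_le_self)) h3
  obtain ⟨S, hS⟩ := Subgroup.exists_left_complement'_of_coprime hcop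
  refine ⟨S, ?_, hS⟩
  rw [← Subgroup.normalizer_eq_top_iff, eq_top_iff, ← hS.sup_eq_top]
  refine sup_le Subgroup.le_normalizer (normalizer_le_of_conj_mem fun o ho s hs => ?_)
  have : s * o = o * s := Subtype.ext (hcen o (Subgroup.mem_subgroupOf.1 ho) s s.2)
  rwa [← this, mul_inv_cancel_right]

theorem ResidualConditions.coprime (h : ResidualConditions σ G) :
    Nat.Coprime (Nat.card (sigmaCommutator σ G)) (sigmaCommutator σ G).index :=
  Nat.coprime_of_dvd h.hall

theorem isPowerAutomorphism_conjNormal [Finite G] {D : Subgroup G} [D.Normal]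
    (h : ∀ K ≤ D, K.Normal) (g : G) : IsPowerAutomorphism (MulAut.conjNormal g : MulAut D) := by
  intro K
  have hinj : Function.Injective (MulAut.conjNormal g : MulAut D).toMonoidHom :=
    (MulAut.conjNormal g : MulAut D).injective
  refine Subgroup.eq_of_le_of_card_ge ?_ (Subgroup.card_map_of_injective hinj).ge
  rintro _ ⟨x, hx, rfl⟩
  obtain ⟨y, hy, hyx⟩ := (h (K.map D.subtype) (Subgroup.map_subtype_le K)).conj_mem (x : G)
    ⟨x, hx, rfl⟩ g
  have : (MulAut.conjNormal g : MulAut D) x = y :=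
    Subtype.ext ((MulAut.conjNormal_apply g x).trans hyx.symm)
  change (MulAut.conjNormal g : MulAut D) x ∈ K
  rwa [this]

/-- The structural conditions hold if all `σ`-subnormal subgroups belong to `τ G`. -/
theorem exists_structureConditions {G : Type u} [Group G] [Finite G] (hσ : IsPrimePartition σ)
    {τ : SubgroupSystem.{u}} (hτ : IsSigmaSpecial σ τ) (hG : IsSigmaSoluble σ G)
    (h : ∀ A : Subgroup G, IsSigmaSubnormal σ A → A ∈ τ G) :
    IsPSigmaTGroup σ G ∧ ∃ M : Subgroup G, StructureConditions σ τ (sigmaCommutator σ G) M := by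
  have hS := hG.hasSigmaSeries
  have hF := hS.isSigmaFull hσ
  have hP : ∀ A : Subgroup G, IsSigmaSubnormal σ A → PermutesHalls σ A := fun A hA =>
    (hτ.permutable G hF A hA (h A hA)).permutesHalls
  have hN := normalisesSections_of_permutesHalls hσ hS hP
  have hR := hN.residualConditions hσ hG
  refine ⟨isPSigmaTGroup_of_permutesHalls hσ hS hP, ?_⟩
  obtain ⟨M, hM⟩ := Subgroup.exists_right_complement'_of_coprime hR.coprime
  refine ⟨M, ⟨⟨inferInstance, hM⟩, hR.comm, hR.coprime, hN.odd_card_residual hσ hG, ?_, ?_,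
    isPowerAutomorphism_conjNormal hR.normal_of_le, ?_⟩⟩
  · rw [isSigmaNilpotent_iff hσ, eq_bot_iff]
    refine sigmaCommutator_le fun p q hpq x y hx hy => ?_
    have hmem : ((⁅x, y⁆ : M) : G) ∈ sigmaCommutator σ G :=
      commutator_mem_sigmaCommutator hpq hx.coe hy.coe
    exact Subtype.ext (Subgroup.mem_bot.1 (hM.disjoint.le_bot ⟨hmem, (⁅x, y⁆ : M).2⟩))
  · intro U
    obtain ⟨φ, hφ, hker, -⟩ := exists_retraction hM
    have hle : sigmaCommutator σ G ≤ U.comap φ := by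
      rw [← hker]
      exact fun x hx => by rw [Subgroup.mem_comap, MonoidHom.mem_ker.1 hx]; exact U.one_mem
    -- The preimage of U contains D, so it is `σ`-subnormal and lies in `τ G`; its image under the
    -- retraction is U.
    have := hτ.map_mem G M hF ((hS.subgroup M).isSigmaFull hσ) φ hφ _
      (h _ ((permutesHalls_of_residual_le hσ hle).isSigmaSubnormal hσ hS))
    rwa [Subgroup.map_comap_eq_self_of_surjective hφ] at this
  · intro i
    obtain ⟨H, hH⟩ := hS.exists_isHallPi hσ i
    exact ⟨H, hH, hR.hasNormalComplementIn hH⟩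

end ResidualStructure

/-! ### From the structure of G back to `τ` -/

section Converse

variable {I : Type v} {σ : I → Set ℕ} {G : Type*} [Group G] {G' : Type*} [Group G']

theorem ResidualConditions.of_surjective [Finite G] (hσ : IsPrimePartition σ) (h : ResidualConditions σ G)
    {f : G →* G'} (hf : Function.Surjective f) : ResidualConditions σ G' := by
  have hmap : (sigmaCommutator σ G).map f = sigmaCommutator σ G' := map_sigmaCommutator hf
  refine ⟨?_, ?_, ?_, ?_⟩ <;> rw [← hmap]
  · rintro _ ⟨x, hx, rfl⟩ _ ⟨y, hy, rfl⟩
    exact (h.comm x hx y hy).map f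
  · intro p hp hd hi
    exact h.hall p hp (hd.trans (Subgroup.card_map_dvd _ f))
      (hi.trans (Subgroup.index_map_dvd _ hf))
  · intro K hK
    have : (K.comap f ⊓ sigmaCommutator σ G).map f = K := by
      apply le_antisymm
      · rintro _ ⟨x, hx, rfl⟩
        exact hx.1
      · intro y hy
        obtain ⟨x, hx, rfl⟩ := hK hy
        exact ⟨x, ⟨hy, hx⟩, rfl⟩
    rw [← this]
    exact (h.normal_of_le _ inf_le_right).map f hf
  · intro i p r hp hr y hy hyp z hz
    obtain ⟨x, hxp, hx⟩ := (IsPElt.of_coe (x := ⟨y, hy⟩) hyp).lift (hσ.prime hp)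
      (f.subgroupMap_surjective _)
    obtain ⟨z, hz', rfl⟩ := hz.lift (hσ.prime hr) hf
    have hx' : f x = y := congrArg Subtype.val hx
    rw [← hx']
    exact (h.commute i p r hp hr x x.2 hxp.coe z hz').map f

/-- A `p`-group `E` with `E = [E, a]` for a `q`-element `a` of a `σ`-subnormal subgroup `A`, where
`p` and `q` lie in different classes, is contained in `A`. -/
theorem le_of_forall_commutator [Finite G] {A B E : Subgroup G}
    (h : Relation.ReflTransGen (SigmaSubnormalStep σ) A B) (hEB : E ≤ B) {p q : ℕ}
    (hpq : SepPrimes σ p q) (hE : IsPGroup p E) {a : G} (ha : a ∈ A) (haq : IsPElt q a)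
    (hEa : ∀ e ∈ E, ∃ c ∈ E, ⁅c, a⁆ = e) : E ≤ A := by
  induction h using Relation.ReflTransGen.head_induction_on with
  | refl => exact hEB
  | head hstep hrest ih =>
    rename_i A A₁
    rw [sigmaSubnormalStep_iff] at hstep
    obtain ⟨hle, hstep⟩ := hstep
    have hEA := ih (hle ha)
    -- A subgroup normalised by E and containing a contains [E, a] = E. In a `σ j`-step either q is
    -- outside `σ j` and a lies in C, or p is outside and E lies in C at once.
    have hmem : ∀ C : Subgroup G, A₁ ≤ Subgroup.normalizer (C : Set G) → a ∈ C → E ≤ C := by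
      intro C hC haC e he
      obtain ⟨c, hc, rfl⟩ := hEa e he
      exact C.mul_mem ((Subgroup.mem_normalizer_iff.1 (hC (hEA hc)) a).1 haC) (C.inv_mem haC)
    rcases hstep with hn | ⟨j, C, hCA, hC, hj⟩
    · exact hmem A hn ha
    · by_cases hpj : p ∈ σ j
      · exact (hmem C hC (pElt_mem_of_isPiNumber_relIndex hC hj hpq.2.1 (hpq.2.2 j hpj)
          (hle ha) haq)).trans hCA
      · exact fun e he => hCA (pElt_mem_of_isPiNumber_relIndex hC hj hpq.1 hpj (hEA he)
          (IsPGroup.isPElt hE he))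

/-- A `σ`-subnormal subgroup meeting the residual trivially centralises it. -/
theorem ResidualConditions.commute_of_inf_eq_bot [Finite G] (hσ : IsPrimePartition σ)
    (h : ResidualConditions σ G) {A : Subgroup G} (hA : IsSigmaSubnormal σ A)
    (hAD : A ⊓ sigmaCommutator σ G = ⊥) {a d : G} (ha : a ∈ A) (hd : d ∈ sigmaCommutator σ G) :
    Commute a d := by
  have key : ∀ p q : ℕ, p.Prime → q.Prime → ∀ x ∈ sigmaCommutator σ G, IsPElt p x →
      ∀ a ∈ A, IsPElt q a → Commute a x := by
    intro p q hp hq x hx hxp a ha haq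
    rcases IsPrimePartition.exists_common_or_sep σ hp hq with ⟨i, hpi, hqi⟩ | hpq
    · exact (h.commute i p q hpi hqi x hx hxp a haq).symm
    · by_contra hax
      have hle : Subgroup.zpowers x ≤ sigmaCommutator σ G := Subgroup.zpowers_le.2 hx
      have hpow : ∀ w ∈ Subgroup.zpowers x, a * w * a⁻¹ ∈ Subgroup.zpowers w := fun w hw =>
        (h.normal_of_le _ (Subgroup.zpowers_le.2 (hle hw))).conj_mem w (Subgroup.mem_zpowers w) a
      have hfix : ∀ w ∈ Subgroup.zpowers x, Commute a w → w = 1 := by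
        intro w hw haw
        by_contra hw1
        exact hax (commute_of_power_of_commute hp hq (hpq.ne hσ) haq hxp.isPGroup_zpowers hpow hw
          hw1 haw (Subgroup.mem_zpowers x))
      have hEA : Subgroup.zpowers x ≤ A := by
        refine le_of_forall_commutator hA le_top hpq hxp.isPGroup_zpowers ha haq fun e he => ?_
        obtain ⟨y, hy, rfl⟩ := inv_mul_conj_surj
          (fun x hx => (Subgroup.zpowers_le.2 hx) (hpow x hx)) hfix he
        exact ⟨y⁻¹, Subgroup.inv_mem _ hy, by rw [commutatorElement_def]; group⟩
      have : x ∈ A ⊓ sigmaCommutator σ G := ⟨hEA (Subgroup.mem_zpowers x), hx⟩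
      rw [hAD, Subgroup.mem_bot] at this
      rw [this] at hax
      exact hax (Commute.one_right a)
  have h1 : ∀ q : ℕ, q.Prime → ∀ a ∈ A, IsPElt q a →
      sigmaCommutator σ G ≤ Subgroup.centralizer {a} := by
    intro q hq a ha haq
    refine le_of_pElt_mem fun p hp x hx hxp => ?_
    rw [Subgroup.mem_centralizer_singleton_iff]
    exact (key p q hp hq x hx hxp a ha haq).symm
  have h2 : A ≤ Subgroup.centralizer {d} := by
    refine le_of_pElt_mem fun q hq a ha haq => ?_
    have := h1 q hq a ha haq hd
    rw [Subgroup.mem_centralizer_singleton_iff] at this ⊢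
    exact this.symm
  exact Subgroup.mem_centralizer_singleton_iff.1 (h2 ha)

/-- A nontrivial `p`-element can lie in a subgroup meeting the residual trivially only if `p` does
not divide the order of the residual. -/
theorem ResidualConditions.not_dvd_card [Finite G] (h : ResidualConditions σ G) {A : Subgroup G}
    (hAD : A ⊓ sigmaCommutator σ G = ⊥) {p : ℕ} (hp : p.Prime) {x : G} (hx : x ∈ A)
    (hxp : IsPElt p x) (hx1 : x ≠ 1) : ¬ p ∣ Nat.card (sigmaCommutator σ G) := by
  intro hd
  have hidx := h.hall p hp hd
  have hxD : x ∈ sigmaCommutator σ G := by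
    refine pElt_mem_of_isPiNumber_relIndex (π := {p}ᶜ) (B := ⊤)
      (by rw [Subgroup.normalizer_eq_top]) ?_ hp (by simp) (Subgroup.mem_top x) hxp
    rw [Subgroup.relIndex_top_right]
    rintro s - hs rfl
    exact hidx hs
  have : x ∈ A ⊓ sigmaCommutator σ G := ⟨hx, hxD⟩
  rw [hAD] at this
  exact hx1 (Subgroup.mem_bot.1 this)

/-- The commutator lies in D, which x centralises, so it is a p-element of D; but p does not divide
|D| when x ≠ 1. -/
theorem ResidualConditions.commute_of_sep [Finite G] (hσ : IsPrimePartition σ)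
    (h : ResidualConditions σ G) {A : Subgroup G} (hA : IsSigmaSubnormal σ A)
    (hAD : A ⊓ sigmaCommutator σ G = ⊥) {p q : ℕ} (hpq : SepPrimes σ p q) {x g : G} (hx : x ∈ A)
    (hxp : IsPElt p x) (hg : IsPElt q g) : Commute g x := by
  by_cases hx1 : x = 1
  · rw [hx1]; exact Commute.one_right g
  have hd : ⁅g, x⁆ ∈ sigmaCommutator σ G := commutator_mem_sigmaCommutator hpq.symm hg hxp
  have hc := hxp.commutator (h.commute_of_inf_eq_bot hσ hA hAD hx hd).symm
  have h1 : (⟨⁅g, x⁆, hd⟩ : sigmaCommutator σ G) = 1 :=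
    (IsPElt.of_coe (x := ⟨⁅g, x⁆, hd⟩) hc).eq_one_of_not_dvd hpq.1 pow_card_eq_one'
      (h.not_dvd_card hAD hpq.1 hx hxp hx1)
  exact commutatorElement_eq_one_iff_commute.1 (congrArg Subtype.val h1)

/-- If x = dm, then d and x commute, so x and m have the same |D|-th power; x is recovered from it
because p does not divide |D|. Applied with a complement of D and with Hall subgroups as M. -/
theorem ResidualConditions.mem_of_mem_sup [Finite G] (hσ : IsPrimePartition σ)
    (h : ResidualConditions σ G) {A : Subgroup G} (hA : IsSigmaSubnormal σ A)
    (hAD : A ⊓ sigmaCommutator σ G = ⊥) {p : ℕ} (hp : p.Prime) {x : G} (hx : x ∈ A)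
    (hxp : IsPElt p x) {M : Subgroup G} (hxM : x ∈ sigmaCommutator σ G ⊔ M) : x ∈ M := by
  by_cases hx1 : x = 1
  · rw [hx1]; exact M.one_mem
  rw [← SetLike.mem_coe, Subgroup.normal_mul] at hxM
  obtain ⟨d, hd, m, hm, he⟩ := hxM
  simp only at he
  refine hxp.mem_of_pow_mem ((hp.coprime_iff_not_dvd).2 (h.not_dvd_card hAD hp hx hxp hx1)) ?_
  have hc : Commute d⁻¹ x := (h.commute_of_inf_eq_bot hσ hA hAD hx hd).symm.inv_left
  have hd1 : d ^ Nat.card (sigmaCommutator σ G) = 1 :=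
    congrArg Subtype.val (pow_card_eq_one' (x := (⟨d, hd⟩ : sigmaCommutator σ G)))
  have hm' : m = d⁻¹ * x := by rw [← he]; group
  have : m ^ Nat.card (sigmaCommutator σ G) = x ^ Nat.card (sigmaCommutator σ G) := by
    rw [hm', hc.mul_pow, inv_pow, hd1, inv_one, one_mul]
  rw [← this]
  exact M.pow_mem hm _

theorem piGen_union {π ρ : Set ℕ} {K : Subgroup G} :
    piGen (π ∪ ρ) K = piGen π K ⊔ piGen ρ K := by
  apply le_antisymm
  · refine piGen_le fun p hp hpπ x hx hxp => hpπ.elim (fun h => ?_) fun h => ?_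
    · exact Subgroup.mem_sup_left (mem_piGen hp h hx hxp)
    · exact Subgroup.mem_sup_right (mem_piGen hp h hx hxp)
  · exact sup_le (piGen_le fun p hp h x hx hxp => mem_piGen hp (Or.inl h) hx hxp)
      (piGen_le fun p hp h x hx hxp => mem_piGen hp (Or.inr h) hx hxp)

/-- The `σ j`-part of A lies in every Hall `σ j`-subgroup H, and the `σ j'`-part is centralised by
H. -/
theorem ResidualConditions.permutesHalls_of_inf_eq_bot [Finite G] (hσ : IsPrimePartition σ)
    (h : ResidualConditions σ G) {A : Subgroup G} (hA : IsSigmaSubnormal σ A)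
    (hAD : A ⊓ sigmaCommutator σ G = ⊥) : PermutesHalls σ A := by
  intro j H hH
  have hsup : piGen (σ j) A ⊔ piGen (σ j)ᶜ A = A := by
    refine le_antisymm (sup_le piGen_le_self piGen_le_self) ?_
    rw [← piGen_union, Set.union_compl_self]
    exact le_of_pElt_mem fun p hp x hx hxp => mem_piGen hp (Set.mem_univ p) hx hxp
  rw [← hsup]
  refine Permutes.sup_left (permutes_of_le ?_) (permutes_of_le_normalizer ?_)
  · refine piGen_le fun p hp hpj x hx hxp => h.mem_of_mem_sup hσ hA hAD hp hx hxp ?_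
    rw [sup_comm, hH.sup_residual hσ]
    exact Subgroup.mem_sup_left (mem_piGen hp hpj (Subgroup.mem_top x) hxp)
  · have hc : H ≤ Subgroup.centralizer (piGen (σ j)ᶜ A : Set G) := by
      refine le_of_pElt_mem fun r hr z hz hzr => ?_
      by_cases hrj : r ∈ σ j
      · have : piGen (σ j)ᶜ A ≤ Subgroup.centralizer {z} := by
          refine piGen_le fun p hp hpj x hx hxp => ?_
          rw [Subgroup.mem_centralizer_singleton_iff]
          exact (h.commute_of_sep hσ hA hAD (hσ.sep hrj hp hpj).symm hx hxp hzr).symm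
        exact fun y hy => Subgroup.mem_centralizer_singleton_iff.1 (this hy)
      · rw [isPiGroup_coe_iff.1 hH.1 r hr hrj z hz hzr]
        exact Subgroup.one_mem _
    refine normalizer_le_of_conj_mem fun b hb x hx => ?_
    have := hc hb x hx
    rwa [← this, mul_inv_cancel_right]

theorem map_inf_map_eq_bot {A D : Subgroup G} {f : G →* G'} (hker : f.ker = A ⊓ D) :
    A.map f ⊓ D.map f = ⊥ := by
  rw [eq_bot_iff]
  rintro _ ⟨⟨a, ha, rfl⟩, d, hd, he⟩
  have h1 : d⁻¹ * a ∈ f.ker := by rw [MonoidHom.mem_ker, map_mul, map_inv, he, inv_mul_cancel]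
  rw [hker] at h1
  have h2 : a ∈ f.ker := by
    rw [hker]
    exact ⟨ha, by simpa using D.mul_mem hd h1.2⟩
  exact Subgroup.mem_bot.2 h2

/-- Under the conditions on the residual, all `σ`-subnormal subgroups permute with all Hall
`σ i`-subgroups. -/
theorem ResidualConditions.permutesHalls [Finite G] (hσ : IsPrimePartition σ)
    (h : ResidualConditions σ G) {A : Subgroup G} (hA : IsSigmaSubnormal σ A) :
    PermutesHalls σ A := by
  have hV : (A ⊓ sigmaCommutator σ G).Normal := h.normal_of_le _ inf_le_right
  set f := QuotientGroup.mk' (A ⊓ sigmaCommutator σ G) with hfdef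
  have hf : Function.Surjective f := QuotientGroup.mk'_surjective _
  have hker : f.ker = A ⊓ sigmaCommutator σ G := QuotientGroup.ker_mk' _
  have hbot := map_inf_map_eq_bot hker
  rw [map_sigmaCommutator hf] at hbot
  have hP := (h.of_surjective hσ hf).permutesHalls_of_inf_eq_bot hσ (hA.map_of_surjective hf) hbot
  intro i H hH
  have hH' : IsHallPi (σ i) (H.map f) :=
    ⟨IsPiNumber.of_dvd hH.1 (Subgroup.card_map_dvd _ f),
      fun p hp hd => hH.2 p hp (hd.trans (Subgroup.index_map_dvd _ hf))⟩
  refine permutes_of_forall fun b hb a ha => ?_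
  have h1 : f b * f a ∈ (SetLike.coe (H.map f) : Set (G ⧸ A ⊓ sigmaCommutator σ G)) *
      SetLike.coe (A.map f) :=
    ⟨f b, ⟨b, hb, rfl⟩, f a, ⟨a, ha, rfl⟩, rfl⟩
  rw [← hP i _ hH'] at h1
  obtain ⟨_, ⟨a', ha', rfl⟩, _, ⟨b', hb', rfl⟩, he⟩ := h1
  simp only at he
  have h2 : b * a * b'⁻¹ * a'⁻¹ ∈ f.ker := by
    rw [MonoidHom.mem_ker]
    simp only [map_mul, map_inv]
    rw [← he]; group
  rw [hker] at h2
  exact ⟨b * a * b'⁻¹ * a'⁻¹ * a', A.mul_mem h2.1 ha', b', hb', by simp⟩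

/-- The hypothesis concerns overgroups of D rather than M, so that it passes to quotients of G; a
complement is chosen afresh. The `σ i`-parts of A lie in it, are lifted by (***) and joined by (**).
-/
theorem ResidualConditions.mem_of_inf_eq_bot {G : Type u} [Group G] [Finite G]
    (hσ : IsPrimePartition σ) {τ : SubgroupSystem.{u}} (hτ : IsSigmaSpecial σ τ)
    (hG : IsSigmaSoluble σ G) (h : ResidualConditions σ G)
    (hU : ∀ U : Subgroup G, sigmaCommutator σ G ≤ U → U ∈ τ G)
    {A : Subgroup G} (hA : IsSigmaSubnormal σ A)
    (hAD : A ⊓ sigmaCommutator σ G = ⊥) : A ∈ τ G := by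
  classical
  have hS := hG.hasSigmaSeries
  have hF := hS.isSigmaFull hσ
  have hT := isPSigmaTGroup_of_permutesHalls hσ hS fun A hA => h.permutesHalls hσ hA
  obtain ⟨M, hM⟩ := Subgroup.exists_right_complement'_of_coprime h.coprime
  obtain ⟨φ, hφ, hker, -⟩ := exists_retraction hM
  have hMτ : ∀ U : Subgroup M, U ∈ τ M := by
    intro U
    have hle : sigmaCommutator σ G ≤ U.comap φ := by
      rw [← hker]
      exact fun x hx => by rw [Subgroup.mem_comap, MonoidHom.mem_ker.1 hx]; exact U.one_mem
    have := hτ.map_mem G M hF ((hS.subgroup M).isSigmaFull hσ) φ hφ _ (hU _ hle)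
    rwa [Subgroup.map_comap_eq_self_of_surjective hφ] at this
  have hsub : ∀ π : Set ℕ, IsSigmaSubnormal σ (piGen π A) := fun π =>
    hA.of_normalizer piGen_le_self (normalizer_le_normalizer_piGen Subgroup.le_normalizer)
  have hprim : ∀ B : Subgroup G, B ≤ M → IsSigmaSubnormal σ B → IsSigmaPrimary σ B → B ∈ τ G := by
    rintro B hBM hB ⟨i, hi⟩
    have he : (B.subgroupOf M).map M.subtype = B := by
      rw [Subgroup.subgroupOf_map_subtype, inf_of_le_left hBM]
    have := hτ.lift_mem G hF hG hT M (by
      rw [sigmaNilpotentResidual_eq hσ]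
      exact ⟨inferInstance, hM⟩) (B.subgroupOf M) ⟨i, by
        rw [IsPiGroup, Nat.card_congr (Subgroup.subgroupOfEquivOfLe hBM).toEquiv]
        exact hi⟩ (by rwa [he]) (hMτ _)
    rwa [he] at this
  have hgen : ∀ i, piGen (σ i) A ∈ τ G := by
    intro i
    refine hprim _ (piGen_le fun p hp hpi x hx hxp => ?_) (hsub _) ⟨i, ?_⟩
    · exact h.mem_of_mem_sup hσ hA hAD hp hx hxp (by rw [hM.sup_eq_top]; trivial)
    · exact SigmaTheory.isPiGroup_piGen fun p q hp hq hpi hqi x hx y hy hxp hyq =>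
        (h.commute_of_sep hσ hA hAD (hσ.sep hpi hq hqi) hx hxp hyq).symm
  have hfin : ∀ F : Finset I, piGen (⋃ i ∈ F, σ i) A ∈ τ G := by
    intro F
    induction F using Finset.induction_on with
    | empty =>
      have : piGen (⋃ i ∈ (∅ : Finset I), σ i) A = ⊥ := by
        rw [eq_bot_iff]
        exact piGen_le fun p hp hpi => by simp at hpi
      rw [this]
      obtain ⟨i, -⟩ := hσ.exists_mem Nat.prime_two
      refine hprim ⊥ bot_le isSigmaSubnormal_of_normal ⟨i, fun p hp hd => ?_⟩
      rw [Subgroup.card_bot] at hd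
      exact absurd hd hp.not_dvd_one
    | insert i F _ ih =>
      rw [Finset.set_biUnion_insert, piGen_union]
      exact hτ.sup_mem G hF _ _ (hsub _) (hsub _) (hgen i) ih
  have hex : ∀ p : ℕ, p.Prime → ∃ i, p ∈ σ i := fun p hp => hσ.exists_mem hp
  have : Nonempty I := ⟨(hex 2 Nat.prime_two).choose⟩
  choose! c hc using hex
  have hAe : piGen (⋃ i ∈ (Nat.card G).primeFactors.image c, σ i) A = A := by
    refine le_antisymm piGen_le_self (le_of_pElt_mem fun p hp x hx hxp => ?_)
    by_cases hx1 : x = 1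
    · rw [hx1]; exact Subgroup.one_mem _
    have hd : p ∣ Nat.card G := by
      by_contra hd
      exact hx1 (hxp.eq_one_of_not_dvd hp pow_card_eq_one' hd)
    refine mem_piGen hp (Set.mem_biUnion (Finset.mem_coe.2 (Finset.mem_image_of_mem c
      (Nat.mem_primeFactors.2 ⟨hp, hd, Nat.card_pos.ne'⟩))) (hc p hp)) hx hxp
  rw [← hAe]
  exact hfin _

/-- Modulo the normal subgroup A ∩ D the image of A meets the residual trivially, and A is the full
preimage of that image. -/
theorem ResidualConditions.mem {G : Type u} [Group G] [Finite G]
    (hσ : IsPrimePartition σ) {τ : SubgroupSystem.{u}} (hτ : IsSigmaSpecial σ τ)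
    (hG : IsSigmaSoluble σ G) (h : ResidualConditions σ G)
    (hU : ∀ U : Subgroup G, sigmaCommutator σ G ≤ U → U ∈ τ G)
    {A : Subgroup G} (hA : IsSigmaSubnormal σ A) : A ∈ τ G := by
  have hV : (A ⊓ sigmaCommutator σ G).Normal := h.normal_of_le _ inf_le_right
  set f := QuotientGroup.mk' (A ⊓ sigmaCommutator σ G) with hfdef
  have hf : Function.Surjective f := QuotientGroup.mk'_surjective _
  have hker : f.ker = A ⊓ sigmaCommutator σ G := QuotientGroup.ker_mk' _
  have hbot := map_inf_map_eq_bot hker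
  rw [map_sigmaCommutator hf] at hbot
  have hG' := hG.of_surjective hf
  have hF := hG.hasSigmaSeries.isSigmaFull hσ
  have hF' := hG'.hasSigmaSeries.isSigmaFull hσ
  have := (h.of_surjective hσ hf).mem_of_inf_eq_bot hσ hτ hG' (fun U hDU => by
    have h1 : sigmaCommutator σ G ≤ U.comap f := by
      rw [← Subgroup.map_le_iff_le_comap, map_sigmaCommutator hf]
      exact hDU
    have := hτ.map_mem _ _ hF hF' f hf _ (hU _ h1)
    rwa [Subgroup.map_comap_eq_self_of_surjective hf] at this) (hA.map_of_surjective hf) hbot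
  have h2 := hτ.comap_mem _ _ hF hF' f hf _ this
  rwa [Subgroup.comap_map_eq_self (by rw [hker]; exact inf_le_left)] at h2

theorem StructureConditions.residualConditions {G : Type u} [Group G] [Finite G]
    (hσ : IsPrimePartition σ) {τ : SubgroupSystem.{u}} {M : Subgroup G}
    (h : StructureConditions σ τ (sigmaCommutator σ G) M) : ResidualConditions σ G := by
  set D := sigmaCommutator σ G with hDdef
  have hnormal : ∀ K ≤ D, K.Normal := by
    refine fun K hK => ⟨fun x hx g => ?_⟩
    have h1 := h.power g (K.subgroupOf D)
    have h2 : (MulAut.conjNormal g : MulAut D) ⟨x, hK hx⟩ ∈ K.subgroupOf D := by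
      rw [← h1]
      exact ⟨⟨x, hK hx⟩, hx, rfl⟩
    rw [Subgroup.mem_subgroupOf, MulAut.conjNormal_apply] at h2
    exact h2
  refine ⟨h.abelian, fun p hp h1 h2 => ?_, hnormal, ?_⟩
  · exact hp.one_lt.ne' (Nat.eq_one_of_dvd_coprimes h.hall h1 h2)
  · intro i p r hp hr x hx hxp z hz
    obtain ⟨H, hH, hOH, S, hS, hSO⟩ := h.complement i
    rw [map_piCore_eq h.abelian] at hOH hSO
    obtain ⟨g, hg⟩ := hH.exists_conj_mem (hσ.prime hr) hr hz
    set O := piGen (σ i) D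
    have hO : O.Normal := hnormal O piGen_le_self
    -- O and S are normal in H and disjoint, so they commute; as O is abelian, O is central in H =
    -- SO. Conjugating z into H then settles the general case.
    have hcen : ∀ y ∈ H, ∀ o ∈ O, Commute y o := by
      intro y hy o ho
      have ho' : (⟨o, hOH ho⟩ : H) ∈ O.subgroupOf H := ho
      have hyS : (⟨y, hy⟩ : H) ∈ ((S ⊔ O.subgroupOf H : Subgroup H) : Set H) := by
        rw [hSO.sup_eq_top]; trivial
      rw [Subgroup.normal_mul] at hyS
      obtain ⟨s, hs, o', ho'', he⟩ := hyS
      have hOn : (O.subgroupOf H).Normal := inferInstance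
      have c1 : Commute s ⟨o, hOH ho⟩ :=
        Subgroup.commute_of_normal_of_disjoint S (O.subgroupOf H) hS hOn hSO.disjoint s _ hs ho'
      have c2 : Commute o' ⟨o, hOH ho⟩ := Subtype.ext
        (h.abelian _ (piGen_le_self (Subgroup.mem_subgroupOf.1 ho'')) _ (piGen_le_self ho))
      have := c1.mul_left c2
      simp only at he
      rw [he] at this
      exact congrArg Subtype.val this.eq
    have hxO : x ∈ O := mem_piGen (hσ.prime hp) hp hx hxp
    have hc := hcen _ hg (g⁻¹ * x * g) (by simpa using hO.conj_mem x hxO g⁻¹)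
    have e1 : g * (g⁻¹ * z * g) * g⁻¹ = z := by group
    have e2 : g * (g⁻¹ * x * g) * g⁻¹ = x := by group
    rw [← e1, ← e2]
    exact ((Commute.conj_iff g).2 hc).symm

theorem StructureConditions.mem_of_residual_le {G : Type u} [Group G] [Finite G]
    (hσ : IsPrimePartition σ) {τ : SubgroupSystem.{u}} (hτ : IsSigmaSpecial σ τ)
    (hG : IsSigmaSoluble σ G) {M : Subgroup G}
    (h : StructureConditions σ τ (sigmaCommutator σ G) M) {U : Subgroup G}
    (hU : sigmaCommutator σ G ≤ U) : U ∈ τ G := by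
  obtain ⟨φ, hφ, hker, -⟩ := exists_retraction h.semidirect.2
  have := hτ.comap_mem G M (hG.hasSigmaSeries.isSigmaFull hσ)
    ((hG.hasSigmaSeries.subgroup M).isSigmaFull hσ) φ hφ (U.map φ) (h.mem _)
  rwa [Subgroup.comap_map_eq_self (by rwa [hker])] at this

end Converse

end SigmaTheory

/-! ### The theorem -/

open SigmaTheory
theorem theorem2p11 {I : Type v} (σ : I → Set ℕ) (hσ : IsPrimePartition σ)
    (τ : SubgroupSystem.{u}) (hτ : IsSigmaSpecial σ τ)
    (G : Type u) [Group G] [Finite G] (hG : IsSigmaSoluble σ G) :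
    ((∀ A : Subgroup G, IsSigmaSubnormal σ A → A ∈ τ G) →
      IsPSigmaTGroup σ G ∧
        ∃ M : Subgroup G, StructureConditions σ τ (sigmaNilpotentResidual σ G) M) ∧
    ((∃ M : Subgroup G, StructureConditions σ τ (sigmaNilpotentResidual σ G) M) →
      ∀ A : Subgroup G, IsSigmaSubnormal σ A → A ∈ τ G) := by
  rw [sigmaNilpotentResidual_eq hσ]
  refine ⟨exists_structureConditions hσ hτ hG, ?_⟩
  rintro ⟨M, hM⟩ A hA
  exact (hM.residualConditions hσ).mem hσ hτ hG (fun U hU => hM.mem_of_residual_le hσ hτ hG hU) hA
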